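/- Let $v=e^{2\pi i/3}$, $w=v^2$, $t=v-w=\sqrt{-3}$, and let $G=G_{27}\rtimes Q_8\rtimes Z_3$ be the group of complex $3\times 3$ matrices, acting on column vectors, generated by $$\begin{pmatrix}1&0&0\\0&v&0\\0&0&w\end{pmatrix},\quad \begin{pmatrix}0&1&0\\0&0&1\\1&0&0\end{pmatrix},\quad -\frac t3\begin{pmatrix}1&1&1\\1&v&w\\1&w&v\end{pmatrix},\quad -\frac t3\begin{pmatrix}1&v&v\\w&v&w\\w&w&v\end{pmatrix},\quad \begin{pmatrix}v&0&0\\0&1&0\\0&0&1\end{pmatrix}$$ (the first two generate $G_{27}$, the next two generate $Q_8$). Write $x\cdot y=\sum_i x_i\overline{y_i}$ on $\mathbb C^3$, and let $\mathcal M$ be the set of the twelve vectors $$\begin{array}{cccc}(t,0,0)&(1,1,1)&(v,1,1)&(w,1,1)\\(0,t,0)&(1,v,w)&(1,1,v)&(1,w,1)\\(0,0,t)&(1,w,v)&(1,v,1)&(1,1,w).\end{array}$$ 1. $|G|=648$. The vectors of $\mathcal M$ span $12$ distinct complex lines (the mirrors), and the $24$ distinct complex reflections $x\mapsto x-\frac{x\cdot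 r}{r\cdot r}(1-\lambda)r$ with $r\in\mathcal M$ and $\lambda\in\{v,w\}$ generate $G$. 2. Regard $\mathbb C^3$ as a real $6$-dimensional Euclidean space with inner product $\operatorname{Re}(x\cdot y)$. The multiples $ur$ with $r\in\mathcal M$ and $u^6=1$ form a set $\Phi$ of exactly $72$ vectors, whose orthogonal reflections $x\mapsto x-\frac{2\operatorname{Re}(x\cdot a)}{\operatorname{Re}(a\cdot a)}a$ $(a\in\Phi)$ are exactly $36$ in number. The set $\Phi$ is a root system of type $E_6$ in $\mathbb R^6$, and the $36$ real reflections generate its Weyl group $W(E_6)$. 3. The realification map, which regards an invertible complex $3\times 3$ matrix as a real linear automorphism of $\mathbb C^3=\mathbb R^6$, is injective, and it maps $G$ onto a maximal subgroup of the rotation subgroup $\{g\in W(E_6):\det\nolimits_{\mathbb R}g=1\}$ of $W(E_6)$. -/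

import Mathlib

noncomputable section

namespace HessianE6

/-- The standard `3`-dimensional complex space, and (by restriction of scalars) the
`6`-dimensional real space underlying it. -/
abbrev V : Type := Fin 3 → ℂ

/-- `v = exp(2πi/3)`. -/
def v : ℂ := Complex.exp (2 * Real.pi * Complex.I / 3)

/-- `w = v² = exp(4πi/3)`. -/
def w : ℂ := v ^ 2

/-- `t = v - w = √-3`. -/
def t : ℂ := v - w

/-- The two generators of the extraspecial group `G₂₇`. -/
def g27a : Matrix (Fin 3) (Fin 3) ℂ := !![1, 0, 0; 0, v, 0; 0, 0, w]
def g27b : Matrix (Fin 3) (Fin 3) ℂ := !![0, 1, 0; 0, 0, 1; 1, 0, 0]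

/-- The two generators of the quaternion group `Q₈`. -/
def q8a : Matrix (Fin 3) (Fin 3) ℂ := (-t / 3) • !![1, 1, 1; 1, v, w; 1, w, v]
def q8b : Matrix (Fin 3) (Fin 3) ℂ := (-t / 3) • !![1, v, v; w, v, w; w, w, v]

/-- The matrix of determinant `v` that generates the last factor `Z₃`. -/
def z3a : Matrix (Fin 3) (Fin 3) ℂ := !![v, 0, 0; 0, 1, 0; 0, 0, 1]

lemma v_sq : v ^ 2 = -1 - v := by
  have h3 : IsPrimitiveRoot v 3 := by
    have := Complex.isPrimitiveRoot_exp 3 (by norm_num)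
    simpa [v] using this
  have h := h3.geom_sum_eq_zero (by norm_num)
  simp only [Finset.sum_range_succ, Finset.sum_range_zero] at h
  linear_combination h

lemma v_ne_zero : v ≠ 0 := Complex.exp_ne_zero _

lemma det_g27a : g27a.det = 1 := by
  simp only [g27a, w, Matrix.det_fin_three, Matrix.of_apply, Matrix.cons_val]
  linear_combination (v - 1) * v_sq

lemma det_g27b : g27b.det = 1 := by
  simp [g27b, Matrix.det_fin_three]

lemma det_q8a : q8a.det = 1 := by
  have h := v_sq
  simp only [q8a, t, w, h, Matrix.det_fin_three, Matrix.of_apply, Matrix.cons_val,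
    Matrix.smul_apply, smul_eq_mul]
  ring_nf
  grind

lemma det_q8b : q8b.det = 1 := by
  have h := v_sq
  simp only [q8b, t, w, h, Matrix.det_fin_three, Matrix.of_apply, Matrix.cons_val,
    Matrix.smul_apply, smul_eq_mul]
  ring_nf
  grind

lemma det_z3a : z3a.det = v := by
  simp [z3a, Matrix.det_fin_three]

/-- The group `G₂₇ ⋊ Q₈ ⋊ Z₃` (the triple cover of the Hessian group), as the group of complex
`3 × 3` matrices generated by the five matrices above. -/
def hessianGroup : Subgroup (GL (Fin 3) ℂ) :=
  Subgroup.closure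
    { Matrix.GeneralLinearGroup.mkOfDetNeZero g27a (by rw [det_g27a]; exact one_ne_zero),
      Matrix.GeneralLinearGroup.mkOfDetNeZero g27b (by rw [det_g27b]; exact one_ne_zero),
      Matrix.GeneralLinearGroup.mkOfDetNeZero q8a (by rw [det_q8a]; exact one_ne_zero),
      Matrix.GeneralLinearGroup.mkOfDetNeZero q8b (by rw [det_q8b]; exact one_ne_zero),
      Matrix.GeneralLinearGroup.mkOfDetNeZero z3a (by rw [det_z3a]; exact v_ne_zero) }

/-- The standard Hermitian form `x.r` on `ℂ³`, linear in `x`. -/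
def hdot (x r : V) : ℂ := ∑ i, x i * star (r i)

/-- Vectors spanning the twelve mirrors. -/
def mirrorVectors : Set V :=
  { ![t, 0, 0], ![1, 1, 1], ![v, 1, 1], ![w, 1, 1],
    ![0, t, 0], ![1, v, w], ![1, 1, v], ![1, w, 1],
    ![0, 0, t], ![1, w, v], ![1, v, 1], ![1, 1, w] }

/-- The twelve mirrors, as complex one-dimensional subspaces. -/
def mirrors : Set (Submodule ℂ V) :=
  (fun r : V => Submodule.span ℂ {r}) '' mirrorVectors

/-- The complex reflections of order `3` in the twelve mirrors:
`x ↦ x - (x.r / r.r) (1 - lam) r` with `lam = v` or `lam = w`. -/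
def complexReflections : Set (GL (Fin 3) ℂ) :=
  { g | ∃ r ∈ mirrorVectors, ∃ lam ∈ ({v, w} : Set ℂ), ∀ x : V,
      (g : Matrix (Fin 3) (Fin 3) ℂ).mulVec x =
        x - (hdot x r / hdot r r * (1 - lam)) • r }

/-- The multiples of the twelve vectors by the six complex units `±1, ±v, ±w`, regarded as vectors
of the real `6`-space. -/
def realRoots : Set V :=
  { a | ∃ r ∈ mirrorVectors, ∃ u : ℂ, u ^ 6 = 1 ∧ a = u • r }

/-- The orthogonal reflections of the real `6`-space, with inner product `Re (x.y)`, that negate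
one of the vectors of `realRoots`. -/
def realReflections : Set (V ≃ₗ[ℝ] V) :=
  { s | ∃ a ∈ realRoots, ∀ x : V,
      s x = x - (2 * (hdot x a).re / (hdot a a).re) • a }

/-- The group generated by the real reflections. -/
def realReflectionGroup : Subgroup (V ≃ₗ[ℝ] V) := Subgroup.closure realReflections

/-- Realification: an invertible complex `3 × 3` matrix as an automorphism of the
real `6`-space. -/
def realify : GL (Fin 3) ℂ →* (V ≃ₗ[ℝ] V) where
  toFun g :=
    { toFun := fun x => (g : Matrix (Fin 3) (Fin 3) ℂ).mulVec x
      invFun := fun x => ((g⁻¹ : GL (Fin 3) ℂ) : Matrix (Fin 3) (Fin 3) ℂ).mulVec x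
      map_add' := fun x y => Matrix.mulVec_add _ x y
      map_smul' := fun c x => Matrix.mulVec_smul _ c x
      left_inv := fun x => by beta_reduce; rw [Matrix.mulVec_mulVec, ← Units.val_mul]; simp
      right_inv := fun x => by beta_reduce; rw [Matrix.mulVec_mulVec, ← Units.val_mul]; simp }
  map_one' := by ext1 x; exact Matrix.one_mulVec x
  map_mul' g h := by ext1 x; exact (Matrix.mulVec_mulVec x _ _).symm

/-- `Φ` is a root system of type `E₆` in the real vector space `M`, and `W` is its Weyl group
(acting on `M`): `Φ` is the set of roots of a crystallographic root system which has a base with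
Cartan matrix `E₆`, and `W` is the image of the Weyl group of that root system. -/
def IsE6WeylGroup {M : Type*} [AddCommGroup M] [Module ℝ M]
    (Φ : Set M) (W : Subgroup (M ≃ₗ[ℝ] M)) : Prop :=
  ∃ (P : RootPairing Φ ℝ M (Module.Dual ℝ M)) (_ : P.IsRootSystem) (_ : P.IsCrystallographic)
    (b : P.Base) (e : Fin 6 ≃ b.support),
    (∀ α : Φ, P.root α = (α : M)) ∧
    b.cartanMatrix.submatrix e e = CartanMatrix.E₆ ∧
    P.weylGroup.map (RootPairing.Equiv.weightHom P) = W

/-- The rotation subgroup of a group of real linear automorphisms of the real `6`-space: its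
elements of (real) determinant `1`. -/
def rotationSubgroup (W : Subgroup (V ≃ₗ[ℝ] V)) : Subgroup (V ≃ₗ[ℝ] V) :=
  W ⊓ (LinearEquiv.det : (V ≃ₗ[ℝ] V) →* ℝˣ).ker

/-- `H` is a maximal subgroup of `K`: it is a proper subgroup of `K`, and the only subgroup of `K`
that properly contains it is `K`. -/
def IsMaximalSubgroupOf {G : Type*} [Group G] (H K : Subgroup G) : Prop :=
  H < K ∧ ∀ L : Subgroup G, H < L → L ≤ K → L = K

end HessianE6

end

noncomputable section

namespace HessianE6

open Matrix

/-! ### Arithmetic of the cube roots of unity -/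

/-! Everything is compared inside `rootAut`, the group of real isometries that preserve both the 72
roots and the 27 minuscule weights. The roots alone would not do: they are also preserved by -1 and
by coordinate transpositions, and the weights exclude these.

The Hessian group H lies in `rootAut`, as is checked on diagonal matrices, the cyclic shift and the
Fourier matrix. It is transitive on roots (`exists_baseRoot_eq`), and a complex linear element of
`rootAut` that fixes the base root is one of the nine matrices diag(1, x, y)
(`eq_diagGL_of_fixes_baseRoot`). Hence |H| = 72 · 9 = 648, and H consists of all complex linear
elements of `rootAut`. The real reflection in the base root is conjugation of one coordinate; it
lies in `rootAut`, so by transitivity all 36 reflections do.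

Each order 3 complex reflection is a product of two real reflections in roots of one complex line
(`realify_complexReflection`). These complex reflections generate H, so H consists of rotations.
Type E₆ is a finite computation in Eisenstein integer coordinates with explicit simple roots.

For maximality, let L lie strictly above H inside the rotations and take g in L outside H. If g
carried each pair a, va to b, vb or b, wb, then it would be complex linear or antilinear as a whole
(`isLinear_or_antilinear`). The first puts g in H; the second is impossible because coordinatewise
conjugation has real determinant -1. So for some root a the image of va is not v or w times the
image of a. The product of the reflections in va and a lies in H; conjugating it by g, then moving
by H, puts in L a product of the reflections in the base root and in a root at 120° outside its
complex line. Conjugation by H spreads this to all roots (`linked_all`), so L contains every product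
of two reflections, hence every rotation. -/

lemma v_cube : v ^ 3 = 1 := by linear_combination (v - 1) * v_sq

lemma w_eq : w = -1 - v := v_sq

lemma t_eq : t = 1 + 2 * v := by rw [t, w_eq]; ring

lemma w_cube : w ^ 3 = 1 := by rw [w, ← pow_mul, mul_comm, pow_mul, v_cube, one_pow]

lemma v_eq : v = ⟨-1 / 2, √3 / 2⟩ := by
  have h : (2 * Real.pi * Complex.I / 3 : ℂ) = ((2 * Real.pi / 3 : ℝ) : ℂ) * Complex.I := by
    push_cast; ring
  have h2 : 2 * Real.pi / 3 = Real.pi - Real.pi / 3 := by ring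
  rw [v, h]
  apply Complex.ext
  · rw [Complex.exp_ofReal_mul_I_re, h2, Real.cos_pi_sub, Real.cos_pi_div_three]; norm_num
  · rw [Complex.exp_ofReal_mul_I_im, h2, Real.sin_pi_sub, Real.sin_pi_div_three]

lemma v_re : v.re = -1 / 2 := by rw [v_eq]

lemma v_im : v.im = √3 / 2 := by rw [v_eq]

lemma w_re : w.re = -1 / 2 := by rw [w_eq]; simp [v_re]; norm_num

lemma w_im : w.im = -(√3 / 2) := by rw [w_eq]; simp [v_im]

lemma t_re : t.re = 0 := by simp [t, v_re, w_re]

lemma t_im : t.im = √3 := by simp [t, v_im, w_im]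

lemma star_v : star v = w := by
  apply Complex.ext <;> simp [v_re, w_re, v_im, w_im]

lemma star_w : star w = v := by rw [← star_v, star_star]

lemma star_t : star t = -t := by rw [t, star_sub, star_v, star_w]; ring

lemma t_sq : t ^ 2 = -3 := by rw [t_eq]; linear_combination 4 * v_sq

lemma t_ne_zero : t ≠ 0 := by
  intro h; have := t_sq; rw [h] at this; norm_num at this

lemma t_mul_t : t * t = -3 := by rw [← sq, t_sq]

lemma v_ne_one : v ≠ 1 := fun h => by
  have := congrArg Complex.re h; rw [v_re] at this; norm_num at this

lemma w_ne_one : w ≠ 1 := fun h => by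
  have := congrArg Complex.re h; rw [w_re] at this; norm_num at this

lemma v_ne_w : v ≠ w := fun h => t_ne_zero (sub_eq_zero.2 h)

lemma w_mul_v : w * v = 1 := by rw [w, ← pow_succ, v_cube]

lemma v_mul_v : v * v = w := by rw [w, sq]

lemma cube_eq_one_iff (x : ℂ) : x ^ 3 = 1 ↔ x = 1 ∨ x = v ∨ x = w := by
  constructor
  · intro h
    have h2 : (x - 1) * ((x - v) * (x - w)) = 0 := by
      rw [w_eq]
      linear_combination h + (1 - x) * v_sq
    simpa [sub_eq_zero] using h2
  · rintro (rfl | rfl | rfl)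
    · simp
    · exact v_cube
    · exact w_cube

lemma sixth_iff (u : ℂ) : u ^ 6 = 1 ↔ u ^ 3 = 1 ∨ (-u) ^ 3 = 1 := by
  have : u ^ 6 - 1 = (u ^ 3 - 1) * (u ^ 3 + 1) := by ring
  rw [← sub_eq_zero, this, mul_eq_zero, sub_eq_zero, Odd.neg_pow (by decide), neg_eq_iff_eq_neg,
    add_eq_zero_iff_eq_neg]

lemma ne_zero_of_cube {x : ℂ} (h : x ^ 3 = 1) : x ≠ 0 := by
  rintro rfl; norm_num at h

lemma ne_zero_of_sixth {x : ℂ} (h : x ^ 6 = 1) : x ≠ 0 := by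
  rintro rfl; norm_num at h

lemma star_mul_self_of_cube {x : ℂ} (h : x ^ 3 = 1) : star x * x = 1 := by
  rcases (cube_eq_one_iff x).1 h with rfl | rfl | rfl
  · simp
  · rw [star_v, w_mul_v]
  · rw [star_w, mul_comm, w_mul_v]

lemma star_mul_self_of_sixth {x : ℂ} (h : x ^ 6 = 1) : star x * x = 1 := by
  rcases (sixth_iff x).1 h with h | h
  · exact star_mul_self_of_cube h
  · simpa using star_mul_self_of_cube h

lemma star_cube {x : ℂ} (h : x ^ 3 = 1) : star x ^ 3 = 1 := by rw [← star_pow, h, star_one]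

lemma sixth_of_cube {x : ℂ} (h : x ^ 3 = 1) : x ^ 6 = 1 := (sixth_iff x).2 (.inl h)

lemma neg_sixth {x : ℂ} (h : x ^ 6 = 1) : (-x) ^ 6 = 1 := by rwa [Even.neg_pow (by decide)]

lemma cube_not_neg {x y : ℂ} (hx : x ^ 3 = 1) (hy : y ^ 3 = 1) : x ≠ -y := by
  rintro rfl
  rw [Odd.neg_pow (by decide), hy] at hx
  norm_num at hx

/-! ### The roots -/

/-- Sorting by zero coordinates splits the 72 roots into 54 = 2 · 27 and 18 = 3 · 6. Diagonal
matrices and the shift preserve each family, which makes this form the convenient one for all later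
case analyses. -/
lemma mem_realRoots_iff (a : V) : a ∈ realRoots ↔
    (∃ c : V, (∀ i, c i ^ 3 = 1) ∧ (a = c ∨ a = -c)) ∨
      ∃ i u, u ^ 6 = 1 ∧ a = Pi.single i (u * t) := by
  constructor
  · rintro ⟨r, hr, u, hu, rfl⟩
    have key : (∃ i, r = Pi.single i t) ∨ ∀ i, r i ^ 3 = 1 := by
      rcases hr with rfl | rfl | rfl | rfl | rfl | rfl | rfl | rfl | rfl | rfl | rfl | rfl
      · exact .inl ⟨0, by ext i; fin_cases i <;> simp⟩
      · right; intro i; fin_cases i <;> simp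
      · right; intro i; fin_cases i <;> simp [v_cube]
      · right; intro i; fin_cases i <;> simp [w_cube]
      · exact .inl ⟨1, by ext i; fin_cases i <;> simp⟩
      · right; intro i; fin_cases i <;> simp [v_cube, w_cube]
      · right; intro i; fin_cases i <;> simp [v_cube]
      · right; intro i; fin_cases i <;> simp [w_cube]
      · exact .inl ⟨2, by ext i; fin_cases i <;> simp⟩
      · right; intro i; fin_cases i <;> simp [v_cube, w_cube]
      · right; intro i; fin_cases i <;> simp [v_cube]
      · right; intro i; fin_cases i <;> simp [w_cube]
    rcases key with ⟨i, rfl⟩ | h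
    · refine .inr ⟨i, u, hu, ?_⟩
      ext j; by_cases hj : j = i
      · subst hj; simp
      · simp [hj]
    · left
      rcases (sixth_iff u).1 hu with h3 | h3
      · exact ⟨u • r, fun i => by simp [mul_pow, h3, h], .inl rfl⟩
      · exact ⟨(-u) • r, fun i => by
          rw [Pi.smul_apply, smul_eq_mul, mul_pow, h3, h, one_mul], .inr (by simp)⟩
  · rintro (⟨c, hc, h⟩ | ⟨i, u, hu, rfl⟩)
    · have key : ∃ r ∈ mirrorVectors, ∃ z : ℂ, z ^ 3 = 1 ∧ c = z • r := by
        have hv := v_cube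
        have hw := w_cube
        have e1 := w_mul_v
        have e2 := v_mul_v
        have e3 : w * w = v := by rw [w_eq]; linear_combination v_sq
        have h0 := hc 0
        -- Dividing by `c 0` leaves nine vectors (1, x, y). Seven are mirror vectors themselves; (1,
        -- v, v) and (1, w, w) need the extra factor `d`, being v(w, 1, 1) and w(v, 1, 1).
        have hc0 : ∀ x y : ℂ, c 1 = c 0 * x → c 2 = c 0 * y → ∀ d : ℂ, d ^ 3 = 1 →
            ∀ r : V, r ∈ mirrorVectors → d * r 0 = 1 → d * r 1 = x → d * r 2 = y →
            ∃ r ∈ mirrorVectors, ∃ z : ℂ, z ^ 3 = 1 ∧ c = z • r := by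
          intro x y hx hy d hd r hr a0 a1 a2
          refine ⟨r, hr, c 0 * d, by rw [mul_pow, h0, hd, one_mul], ?_⟩
          ext i; fin_cases i
          · simp [mul_assoc, a0]
          · simp [mul_assoc, a1, hx]
          · simp [mul_assoc, a2, hy]
        have hq : ∀ i, ∃ x, (x = 1 ∨ x = v ∨ x = w) ∧ c i = c 0 * x := fun i =>
          ⟨c 0 ^ 2 * c i, (cube_eq_one_iff _).1 (by
            rw [mul_pow, hc i, ← pow_mul, mul_comm 2, pow_mul, h0]; simp),
            by linear_combination - c i * h0⟩
        obtain ⟨x, hx, hx'⟩ := hq 1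
        obtain ⟨y, hy, hy'⟩ := hq 2
        have h1 := hc0 x y hx' hy'
        rcases hx with rfl | rfl | rfl <;> rcases hy with rfl | rfl | rfl
        · exact h1 1 (by simp) ![1, 1, 1] (by simp [mirrorVectors]) (by simp) (by simp) (by simp)
        · exact h1 1 (by simp) ![1, 1, v] (by simp [mirrorVectors]) (by simp) (by simp) (by simp)
        · exact h1 1 (by simp) ![1, 1, w] (by simp [mirrorVectors]) (by simp) (by simp) (by simp)
        · exact h1 1 (by simp) ![1, v, 1] (by simp [mirrorVectors]) (by simp) (by simp) (by simp)
        · exact h1 v hv ![w, 1, 1] (by simp [mirrorVectors]) (by simp [mul_comm v, e1]) (by simp)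
            (by simp)
        · exact h1 1 (by simp) ![1, v, w] (by simp [mirrorVectors]) (by simp) (by simp) (by simp)
        · exact h1 1 (by simp) ![1, w, 1] (by simp [mirrorVectors]) (by simp) (by simp) (by simp)
        · exact h1 1 (by simp) ![1, w, v] (by simp [mirrorVectors]) (by simp) (by simp) (by simp)
        · exact h1 w hw ![v, 1, 1] (by simp [mirrorVectors]) (by simp [e1]) (by simp) (by simp)
      obtain ⟨r, hr, z, hz, rfl⟩ := key
      rcases h with rfl | rfl
      · exact ⟨r, hr, z, sixth_of_cube hz, rfl⟩
      · exact ⟨r, hr, -z, neg_sixth (sixth_of_cube hz), by simp⟩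
    · refine ⟨Pi.single i t, ?_, u, hu, ?_⟩
      · have : ∀ i, (Pi.single i t : V) = ![t, 0, 0] ∨ (Pi.single i t : V) = ![0, t, 0] ∨
            (Pi.single i t : V) = ![0, 0, t] := by
          intro i; fin_cases i
          · left; ext j; fin_cases j <;> simp
          · right; left; ext j; fin_cases j <;> simp
          · right; right; ext j; fin_cases j <;> simp
        rcases this i with h | h | h <;> rw [h] <;> simp [mirrorVectors]
      · ext j; by_cases hj : j = i
        · subst hj; simp
        · simp [hj]

lemma vec_mem_realRoots {c : V} (hc : ∀ i, c i ^ 3 = 1) : c ∈ realRoots :=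
  (mem_realRoots_iff c).2 (.inl ⟨c, hc, .inl rfl⟩)

lemma single_mem_realRoots (i : Fin 3) {u : ℂ} (hu : u ^ 6 = 1) :
    Pi.single i (u * t) ∈ realRoots :=
  (mem_realRoots_iff _).2 (.inr ⟨i, u, hu, rfl⟩)

lemma smul_mem_realRoots {a : V} (ha : a ∈ realRoots) {u : ℂ} (hu : u ^ 6 = 1) :
    u • a ∈ realRoots := by
  obtain ⟨r, hr, z, hz, rfl⟩ := ha
  exact ⟨r, hr, u * z, by rw [mul_pow, hu, hz, one_mul], by rw [smul_smul]⟩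

lemma neg_mem_realRoots {a : V} (ha : a ∈ realRoots) : -a ∈ realRoots := by
  simpa using smul_mem_realRoots ha (u := -1) (by norm_num)

lemma mirrorVectors_subset {r : V} (hr : r ∈ mirrorVectors) : r ∈ realRoots :=
  ⟨r, hr, 1, by simp, by simp⟩

lemma hdot_eq (x r : V) : hdot x r = x 0 * star (r 0) + x 1 * star (r 1) + x 2 * star (r 2) := by
  rw [hdot, Fin.sum_univ_three]

lemma hdot_add_left (x y r : V) : hdot (x + y) r = hdot x r + hdot y r := by
  simp only [hdot_eq, Pi.add_apply]; ring

lemma hdot_sub_left (x y r : V) : hdot (x - y) r = hdot x r - hdot y r := by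
  simp only [hdot_eq, Pi.sub_apply]; ring

lemma hdot_smul_left (z : ℂ) (x r : V) : hdot (z • x) r = z * hdot x r := by
  simp only [hdot_eq, Pi.smul_apply, smul_eq_mul]; ring

lemma hdot_real_smul_left (z : ℝ) (x r : V) : hdot (z • x) r = z * hdot x r := by
  simp only [hdot_eq, Pi.smul_apply, Complex.real_smul]; ring

lemma hdot_smul_right (z : ℂ) (x r : V) : hdot x (z • r) = star z * hdot x r := by
  simp only [hdot_eq, Pi.smul_apply, smul_eq_mul, star_mul]; ring

lemma hdot_neg_right (x r : V) : hdot x (-r) = - hdot x r := by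
  simp only [hdot_eq, Pi.neg_apply, star_neg]; ring

lemma hdot_single_right (x : V) (i : Fin 3) (z : ℂ) : hdot x (Pi.single i z) = x i * star z := by
  fin_cases i <;> simp [hdot_eq]

lemma hdot_self_of_mem {a : V} (ha : a ∈ realRoots) : hdot a a = 3 := by
  rcases (mem_realRoots_iff a).1 ha with ⟨c, hc, h⟩ | ⟨i, u, hu, rfl⟩
  · have : hdot c c = 3 := by
      rw [hdot_eq, mul_comm, star_mul_self_of_cube (hc 0), mul_comm, star_mul_self_of_cube (hc 1),
        mul_comm, star_mul_self_of_cube (hc 2)]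
      norm_num
    rcases h with rfl | rfl
    · exact this
    · rw [← this]; simp [hdot_eq]
  · rw [hdot_single_right, Pi.single_eq_same, star_mul, star_t]
    linear_combination (-t * t) * star_mul_self_of_sixth hu - t_mul_t

lemma ne_zero_of_mem_realRoots {a : V} (ha : a ∈ realRoots) : a ≠ 0 := by
  rintro rfl
  have := hdot_self_of_mem ha
  simp [hdot_eq] at this

/-! ### Generators of the Hessian group -/

lemma realify_apply (g : GL (Fin 3) ℂ) (x : V) :
    realify g x = (g : Matrix (Fin 3) (Fin 3) ℂ).mulVec x := rfl

lemma realify_injective : Function.Injective realify := by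
  intro g h hgh
  apply Units.ext
  apply Matrix.ext_of_mulVec_single
  intro i
  rw [← realify_apply, hgh, realify_apply]

lemma realify_smul (g : GL (Fin 3) ℂ) (z : ℂ) (x : V) : realify g (z • x) = z • realify g x :=
  Matrix.mulVec_smul (g : Matrix (Fin 3) (Fin 3) ℂ) z x

/-- A diagonal matrix of cube roots of unity. -/
def diagGL (c : V) (hc : ∀ i, c i ^ 3 = 1) : GL (Fin 3) ℂ :=
  GeneralLinearGroup.mkOfDetNeZero (diagonal c) (by
    rw [det_diagonal, Finset.prod_ne_zero_iff]
    exact fun i _ => ne_zero_of_cube (hc i))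

lemma realify_diagGL (c : V) (hc : ∀ i, c i ^ 3 = 1) (x : V) : realify (diagGL c hc) x = c * x := by
  rw [realify_apply]
  ext i
  exact mulVec_diagonal c x i

/-- The cyclic permutation of coordinates. -/
def shiftGL : GL (Fin 3) ℂ :=
  GeneralLinearGroup.mkOfDetNeZero g27b (by rw [det_g27b]; exact one_ne_zero)

lemma realify_shiftGL (x : V) : realify shiftGL x = ![x 1, x 2, x 0] := by
  rw [realify_apply]
  ext i
  fin_cases i <;> simp [shiftGL, GeneralLinearGroup.mkOfDetNeZero, g27b, mulVec, dotProduct,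
    Fin.sum_univ_three]

/-- The discrete Fourier transform. -/
def fourierGL : GL (Fin 3) ℂ :=
  GeneralLinearGroup.mkOfDetNeZero q8a (by rw [det_q8a]; exact one_ne_zero)

lemma realify_fourierGL (x : V) : realify fourierGL x = (-t / 3) •
    ![x 0 + x 1 + x 2, x 0 + v * x 1 + w * x 2, x 0 + w * x 1 + v * x 2] := by
  rw [realify_apply]
  ext i
  fin_cases i <;> simp [fourierGL, GeneralLinearGroup.mkOfDetNeZero, q8a, mulVec, dotProduct,
    Fin.sum_univ_three] <;> ring

lemma diagGL_mul {c d : V} (hc : ∀ i, c i ^ 3 = 1) (hd : ∀ i, d i ^ 3 = 1) :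
    diagGL (c * d) (fun i => by rw [Pi.mul_apply, mul_pow, hc, hd, one_mul]) =
      diagGL c hc * diagGL d hd := by
  apply realify_injective
  ext1 x
  rw [map_mul, LinearEquiv.mul_apply]
  simp only [realify_diagGL, mul_assoc]

/-- A more convenient generating set: the second quaternion generator is redundant, being diag(1, w,
w) · F · diag(1, v, v) with F the Fourier matrix. -/
lemma hessianGroup_le {K : Subgroup (GL (Fin 3) ℂ)}
    (hd : ∀ c hc, diagGL c hc ∈ K) (hs : shiftGL ∈ K) (hf : fourierGL ∈ K) :
    hessianGroup ≤ K := by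
  rw [hessianGroup, Subgroup.closure_le]
  rintro g (rfl | rfl | rfl | rfl | rfl)
  · change _ ∈ K
    convert hd ![1, v, w] (by intro i; fin_cases i <;> simp [v_cube, w_cube]) using 1
    apply Units.ext
    ext i j
    fin_cases i <;> fin_cases j <;> simp [diagGL, GeneralLinearGroup.mkOfDetNeZero, g27a]
  · exact hs
  · exact hf
  · change _ ∈ K
    convert mul_mem (mul_mem (hd ![1, w, w] (by intro i; fin_cases i <;> simp [w_cube])) hf)
      (hd ![1, v, v] (by intro i; fin_cases i <;> simp [v_cube])) using 1
    apply realify_injective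
    ext1 x
    rw [map_mul, LinearEquiv.mul_apply, map_mul, LinearEquiv.mul_apply, realify_diagGL,
      realify_diagGL, realify_fourierGL, realify_apply]
    have h := v_sq
    ext i
    fin_cases i <;> simp [GeneralLinearGroup.mkOfDetNeZero, q8b, mulVec, dotProduct,
      Fin.sum_univ_three, w_eq] <;> grind
  · change _ ∈ K
    convert hd ![v, 1, 1] (by intro i; fin_cases i <;> simp [v_cube]) using 1
    apply Units.ext
    ext i j
    fin_cases i <;> fin_cases j <;> simp [diagGL, GeneralLinearGroup.mkOfDetNeZero, z3a]

lemma shiftGL_mem : shiftGL ∈ hessianGroup := Subgroup.subset_closure (by simp [shiftGL])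

lemma fourierGL_mem : fourierGL ∈ hessianGroup := Subgroup.subset_closure (by simp [fourierGL])

/-- A subgroup containing `diag(v,1,1)` and the cyclic permutation contains all diagonal matrices
of cube roots of unity. -/
lemma diagGL_mem_of {K : Subgroup (GL (Fin 3) ℂ)} (hs : ∀ i, ∀ h, diagGL (Pi.mulSingle i v) h ∈ K)
    (c : V) (hc : ∀ i, c i ^ 3 = 1) : diagGL c hc ∈ K := by
  have single : ∀ i z, ∀ h : ∀ j, (Pi.mulSingle i z : V) j ^ 3 = 1,
      diagGL (Pi.mulSingle i z) h ∈ K := by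
    intro i z h
    have hz := h i
    rw [Pi.mulSingle_eq_same] at hz
    have h1 : ∀ j, (Pi.mulSingle i v : V) j ^ 3 = 1 := by
      intro j; by_cases hj : j = i
      · subst hj; simp [v_cube]
      · simp [hj]
    rcases (cube_eq_one_iff z).1 hz with rfl | rfl | rfl
    · convert one_mem K
      apply realify_injective
      ext1 x
      rw [realify_diagGL, map_one]
      simp
    · exact hs i _
    · convert mul_mem (hs i h1) (hs i h1) using 1
      rw [← diagGL_mul]
      congr 1
      rw [← Pi.mulSingle_mul, v_mul_v]
  have hm : ∀ i j, (Pi.mulSingle i (c i) : V) j ^ 3 = 1 := by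
    intro i j; by_cases hj : j = i
    · subst hj; simp [hc]
    · simp [hj]
  convert mul_mem (mul_mem (single 0 (c 0) (hm 0)) (single 1 (c 1) (hm 1))) (single 2 (c 2) (hm 2))
    using 1
  apply realify_injective
  ext1 x
  simp only [map_mul, LinearEquiv.mul_apply, realify_diagGL]
  ext i
  fin_cases i <;> simp 

lemma diagGL_mem (c : V) (hc : ∀ i, c i ^ 3 = 1) : diagGL c hc ∈ hessianGroup := by
  have hz : GeneralLinearGroup.mkOfDetNeZero z3a (by rw [det_z3a]; exact v_ne_zero) ∈
      hessianGroup := Subgroup.subset_closure (by simp)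
  have act : ∀ x, realify (GeneralLinearGroup.mkOfDetNeZero z3a
      (by rw [det_z3a]; exact v_ne_zero)) x = ![v * x 0, x 1, x 2] := by
    intro x
    rw [realify_apply]
    ext i
    fin_cases i <;> simp [GeneralLinearGroup.mkOfDetNeZero, z3a, mulVec, dotProduct,
      Fin.sum_univ_three]
  refine diagGL_mem_of (fun i h => ?_) c hc
  fin_cases i
  · convert hz using 1
    apply realify_injective
    ext1 x
    rw [act, realify_diagGL]
    ext i; fin_cases i <;> simp 
  -- The other two coordinates come from conjugating diag(v, 1, 1) by the shift, whose inverse is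
  -- its square.
  · have := mul_mem (mul_mem (mul_mem shiftGL_mem shiftGL_mem) hz) shiftGL_mem
    convert this using 1
    apply realify_injective
    ext1 x
    simp only [map_mul, LinearEquiv.mul_apply, act, realify_diagGL, realify_shiftGL]
    ext i; fin_cases i <;> simp 
  · have := mul_mem (mul_mem shiftGL_mem hz) (mul_mem shiftGL_mem shiftGL_mem)
    convert this using 1
    apply realify_injective
    ext1 x
    simp only [map_mul, LinearEquiv.mul_apply, act, realify_diagGL, realify_shiftGL]
    ext i; fin_cases i <;> simp 

/-! ### The automorphism group of the roots and the minuscule weights -/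

/-- The `27` weights of a minuscule representation. -/
def weights : Set V :=
  { x | ∃ (i : Fin 3) (c d : ℂ), c ^ 3 = 1 ∧ d ^ 3 = 1 ∧
    x = (Pi.single i c - Pi.single (i + 1) d : V) }

/-- The group of isometries that preserve the roots and the weights. -/
def rootAut : Subgroup (V ≃ₗ[ℝ] V) where
  carrier := { g | (∀ x, g x ∈ realRoots ↔ x ∈ realRoots) ∧ (∀ x, g x ∈ weights ↔ x ∈ weights) ∧
    ∀ x y, (hdot (g x) (g y)).re = (hdot x y).re }
  one_mem' := by simp
  mul_mem' := by
    rintro g h ⟨g1, g2, g3⟩ ⟨h1, h2, h3⟩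
    simp [g1, g2, g3, h1, h2, h3]
  inv_mem' := by
    rintro g ⟨g1, g2, g3⟩
    refine ⟨fun x => ?_, fun x => ?_, fun x y => ?_⟩
    · rw [← g1, ← LinearEquiv.mul_apply, mul_inv_cancel, LinearEquiv.coe_one, id]
    · rw [← g2, ← LinearEquiv.mul_apply, mul_inv_cancel, LinearEquiv.coe_one, id]
    · rw [← g3, ← LinearEquiv.mul_apply, ← LinearEquiv.mul_apply, mul_inv_cancel,
        LinearEquiv.coe_one, id, id]

lemma finite_cubes : {x : ℂ | x ^ 3 = 1}.Finite := by
  refine Set.Finite.subset (Set.toFinite {1, v, w}) fun x hx => ?_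
  simpa using (cube_eq_one_iff x).1 hx

lemma finite_sixths : {x : ℂ | x ^ 6 = 1}.Finite := by
  refine Set.Finite.subset (finite_cubes.union (finite_cubes.image Neg.neg)) fun x hx => ?_
  rcases (sixth_iff x).1 hx with h | h
  · exact .inl h
  · exact .inr ⟨-x, h, neg_neg x⟩

lemma finite_mirrorVectors : mirrorVectors.Finite := by
  unfold mirrorVectors; exact Set.toFinite _

lemma finite_realRoots : realRoots.Finite := by
  refine ((finite_mirrorVectors.prod finite_sixths).image fun p => p.2 • p.1).subset ?_
  rintro a ⟨r, hr, u, hu, rfl⟩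
  exact ⟨(r, u), ⟨hr, hu⟩, rfl⟩

lemma finite_weights : weights.Finite := by
  refine (((Set.finite_univ (α := Fin 3)).prod (finite_cubes.prod finite_cubes)).image
    fun p => (Pi.single p.1 p.2.1 - Pi.single (p.1 + 1) p.2.2 : V)).subset ?_
  rintro x ⟨i, c, d, hc, hd, rfl⟩
  exact ⟨(i, c, d), ⟨trivial, hc, hd⟩, rfl⟩

/-- An injective self-map of a finite set is onto, so membership in `rootAut` needs only one
inclusion per set. -/
lemma mem_iff_of_mapsTo {S : Set V} (hS : S.Finite) {g : V ≃ₗ[ℝ] V} (h : ∀ x ∈ S, g x ∈ S) (x : V) :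
    g x ∈ S ↔ x ∈ S := by
  refine ⟨fun hx => ?_, h x⟩
  obtain ⟨y, hy, hyx⟩ := ((hS.injOn_iff_bijOn_of_mapsTo h).1 g.injective.injOn).surjOn hx
  rwa [← g.injective hyx]

lemma mem_rootAut_of_mapsTo {g : V ≃ₗ[ℝ] V} (h1 : ∀ x ∈ realRoots, g x ∈ realRoots)
    (h2 : ∀ x ∈ weights, g x ∈ weights) (h3 : ∀ x y, (hdot (g x) (g y)).re = (hdot x y).re) :
    g ∈ rootAut :=
  ⟨mem_iff_of_mapsTo finite_realRoots h1, mem_iff_of_mapsTo finite_weights h2, h3⟩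

lemma smul_mem_weights {z : ℂ} (hz : z ^ 3 = 1) {x : V} (hx : x ∈ weights) : z • x ∈ weights := by
  obtain ⟨i, c, d, hc, hd, rfl⟩ := hx
  refine ⟨i, z * c, z * d, by rw [mul_pow, hz, hc, one_mul], by rw [mul_pow, hz, hd, one_mul], ?_⟩
  rw [smul_sub, ← smul_eq_mul, ← smul_eq_mul, Pi.single_smul, Pi.single_smul]

lemma diagGL_mem_rootAut (c : V) (hc : ∀ i, c i ^ 3 = 1) : realify (diagGL c hc) ∈ rootAut := by
  have hs : ∀ i z, c * Pi.single i z = Pi.single i (c i * z) := by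
    intro i z; ext j
    by_cases hj : j = i
    · subst hj; simp
    · simp [hj]
  apply mem_rootAut_of_mapsTo
  · intro x hx
    rw [realify_diagGL]
    rcases (mem_realRoots_iff x).1 hx with ⟨d, hd, h⟩ | ⟨i, u, hu, rfl⟩
    · have : c * d ∈ realRoots :=
        vec_mem_realRoots fun i => by rw [Pi.mul_apply, mul_pow, hc, hd, one_mul]
      rcases h with rfl | rfl
      · exact this
      · rw [mul_neg]; exact neg_mem_realRoots this
    · rw [hs, ← mul_assoc]
      exact single_mem_realRoots i (by rw [mul_pow, hu, sixth_of_cube (hc i), one_mul])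
  · rintro x ⟨i, a, b, ha, hb, rfl⟩
    rw [realify_diagGL]
    exact ⟨i, c i * a, c (i + 1) * b, by rw [mul_pow, hc, ha, one_mul],
      by rw [mul_pow, hc, hb, one_mul], by rw [mul_sub, hs, hs]⟩
  · intro x y
    rw [realify_diagGL, realify_diagGL]
    congr 1
    simp only [hdot_eq, Pi.mul_apply, star_mul]
    linear_combination x 0 * star (y 0) * star_mul_self_of_cube (hc 0) +
      x 1 * star (y 1) * star_mul_self_of_cube (hc 1) +
      x 2 * star (y 2) * star_mul_self_of_cube (hc 2)

lemma shiftGL_single (i : Fin 3) (z : ℂ) :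
    realify shiftGL (Pi.single i z) = Pi.single (i + 2) z := by
  rw [realify_shiftGL]
  ext j
  fin_cases i <;> fin_cases j <;> simp

lemma shiftGL_mem_rootAut : realify shiftGL ∈ rootAut := by
  apply mem_rootAut_of_mapsTo
  · intro x hx
    rcases (mem_realRoots_iff x).1 hx with ⟨d, hd, h⟩ | ⟨i, u, hu, rfl⟩
    · have : realify shiftGL d ∈ realRoots := by
        refine vec_mem_realRoots fun i => ?_
        rw [realify_shiftGL]
        fin_cases i <;> simp [hd]
      rcases h with rfl | rfl
      · exact this
      · rw [map_neg]; exact neg_mem_realRoots this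
    · rw [shiftGL_single]
      exact single_mem_realRoots _ hu
  · rintro x ⟨i, a, b, ha, hb, rfl⟩
    exact ⟨i + 2, a, b, ha, hb, by rw [map_sub, shiftGL_single, shiftGL_single, add_right_comm]⟩
  · intro x y
    rw [realify_shiftGL, realify_shiftGL]
    congr 1
    simp only [hdot_eq, cons_val]
    ring

lemma exists_eq_smul_of_cube {c d : ℂ} (hc : c ^ 3 = 1) (hd : d ^ 3 = 1) :
    ∃ x, (x = 1 ∨ x = v ∨ x = w) ∧ d = c * x :=
  ⟨c ^ 2 * d, (cube_eq_one_iff _).1 (by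
    rw [mul_pow, hd, ← pow_mul, mul_comm 2, pow_mul, hc]; simp), by linear_combination - d * hc⟩

/-- By complex linearity these nine vectors account for all roots without zero coordinates: the
three characters of Z/3 go to the axes, the other six stay in the family. -/
lemma fourierGL_table :
    realify fourierGL ![1, 1, 1] = Pi.single 0 (-t) ∧
    realify fourierGL ![1, 1, v] = -![v, v, 1] ∧
    realify fourierGL ![1, 1, w] = ![w, 1, w] ∧
    realify fourierGL ![1, v, 1] = -![v, 1, v] ∧
    realify fourierGL ![1, v, v] = ![1, w, w] ∧
    realify fourierGL ![1, v, w] = Pi.single 2 (-t) ∧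
    realify fourierGL ![1, w, 1] = ![w, w, 1] ∧
    realify fourierGL ![1, w, v] = Pi.single 1 (-t) ∧
    realify fourierGL ![1, w, w] = -![1, v, v] := by
  simp only [realify_fourierGL, t_eq, w_eq]
  have h := v_sq
  refine ⟨?_, ?_, ?_, ?_, ?_, ?_, ?_, ?_, ?_⟩ <;> ext i <;> fin_cases i <;> simp <;> grind

lemma fourierGL_weights (i : Fin 3) :
    realify fourierGL (Pi.single i 1 - Pi.single (i + 1) 1) =
      Pi.single 1 (v ^ (i.1 + 2)) - Pi.single (1 + 1) (v ^ (i.1 * 2 + 1)) ∧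
    realify fourierGL (Pi.single i 1 - Pi.single (i + 1) v) =
      Pi.single 0 (v ^ 2) - Pi.single (0 + 1) (v ^ (i.1 + 1)) ∧
    realify fourierGL (Pi.single i 1 - Pi.single (i + 1) w) =
      Pi.single 2 (v ^ (i.1 * 2 + 2)) - Pi.single (2 + 1) (v ^ 1) := by
  simp only [realify_fourierGL, t_eq, w_eq]
  have h := v_sq
  refine ⟨?_, ?_, ?_⟩ <;> ext j <;> fin_cases i <;> fin_cases j <;> simp <;> grind

lemma fourierGL_mem_rootAut : realify fourierGL ∈ rootAut := by
  have hsq := v_sq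
  have hv := v_cube
  have hw := w_cube
  apply mem_rootAut_of_mapsTo
  · intro x hx
    rcases (mem_realRoots_iff x).1 hx with ⟨c, hc, h⟩ | ⟨i, u, hu, rfl⟩
    · have : realify fourierGL c ∈ realRoots := by
        obtain ⟨x, hx, hx'⟩ := exists_eq_smul_of_cube (hc 0) (hc 1)
        obtain ⟨y, hy, hy'⟩ := exists_eq_smul_of_cube (hc 0) (hc 2)
        have e : c = c 0 • ![1, x, y] := by
          ext i; fin_cases i <;> simp [← hx', ← hy']
        rw [e, realify_smul]
        refine smul_mem_realRoots ?_ (sixth_of_cube (hc 0))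
        have single : ∀ i : Fin 3, Pi.single i (-t) ∈ realRoots := fun i => by
          simpa using single_mem_realRoots i (u := -1) (by norm_num)
        have vec : ∀ p q r : ℂ, p ^ 3 = 1 → q ^ 3 = 1 → r ^ 3 = 1 → ![p, q, r] ∈ realRoots := by
          intro p q r hp hq hr
          refine vec_mem_realRoots fun i => ?_
          fin_cases i <;> simp [hp, hq, hr]
        have hone : (1 : ℂ) ^ 3 = 1 := by norm_num
        obtain ⟨h1, h2, h3, h4, h5, h6, h7, h8, h9⟩ := fourierGL_table
        rcases hx with rfl | rfl | rfl <;> rcases hy with rfl | rfl | rfl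
        · rw [h1]; exact single 0
        · rw [h2]; exact neg_mem_realRoots (vec _ _ _ hv hv hone)
        · rw [h3]; exact vec _ _ _ hw hone hw
        · rw [h4]; exact neg_mem_realRoots (vec _ _ _ hv hone hv)
        · rw [h5]; exact vec _ _ _ hone hw hw
        · rw [h6]; exact single 2
        · rw [h7]; exact vec _ _ _ hw hw hone
        · rw [h8]; exact single 1
        · rw [h9]; exact neg_mem_realRoots (vec _ _ _ hone hv hv)
      rcases h with rfl | rfl
      · exact this
      · rw [map_neg]; exact neg_mem_realRoots this
    · rw [← smul_eq_mul, Pi.single_smul, realify_smul]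
      refine smul_mem_realRoots (vec_mem_realRoots fun j => ?_) hu
      rw [realify_fourierGL]
      have h3 : -t / 3 * t = 1 := by linear_combination - t_mul_t / 3
      fin_cases i <;> fin_cases j <;>
        simp [h3, mul_left_comm (-t / 3), hv, hw]
  · rintro x ⟨i, a, b, ha, hb, rfl⟩
    obtain ⟨y, hy, rfl⟩ := exists_eq_smul_of_cube ha hb
    have e : (Pi.single i a - Pi.single (i + 1) (a * y) : V) =
        a • (Pi.single i 1 - Pi.single (i + 1) y) := by
      rw [smul_sub, ← Pi.single_smul, ← Pi.single_smul, smul_eq_mul, smul_eq_mul, mul_one]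
    rw [e, realify_smul]
    refine smul_mem_weights ha ?_
    have hp : ∀ k : ℕ, (v ^ k) ^ 3 = 1 := fun k => by rw [← pow_mul, mul_comm, pow_mul, hv, one_pow]
    have single : ∀ (i : Fin 3) (k l : ℕ) (z : V),
        z = Pi.single i (v ^ k) - Pi.single (i + 1) (v ^ l) → z ∈ weights := by
      rintro i k l _ rfl
      exact ⟨i, _, _, hp k, hp l, rfl⟩
    obtain ⟨h1, h2, h3⟩ := fourierGL_weights i
    rcases hy with rfl | rfl | rfl
    · exact single 1 _ _ _ h1
    · exact single 0 _ _ _ h2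
    · exact single 2 _ _ _ h3
  · intro x y
    rw [realify_fourierGL, realify_fourierGL, hdot_smul_left, hdot_smul_right]
    congr 1
    simp only [hdot_eq, cons_val, star_mul, star_add, star_v, star_w, star_div₀, star_neg, star_t,
      star_ofNat]
    rw [w_eq, t_eq]
    clear hv hw
    grind

lemma hessianGroup_le_rootAut : hessianGroup ≤ rootAut.comap realify :=
  hessianGroup_le diagGL_mem_rootAut shiftGL_mem_rootAut fourierGL_mem_rootAut

/-- The first coordinate vector of the mirrors. -/
def baseRoot : V := Pi.single 0 t

lemma baseRoot_mem : baseRoot ∈ realRoots := by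
  unfold baseRoot
  simpa using single_mem_realRoots 0 (u := 1) (by simp)

lemma vec3_mul (a b c : ℂ) (x : V) : ![a, b, c] * x = ![a * x 0, b * x 1, c * x 2] := by
  ext i; fin_cases i <;> simp

lemma fourierGL_baseRoot : realify fourierGL baseRoot = ![1, 1, 1] := by
  have h3 : -t / 3 * t = 1 := by linear_combination - t_mul_t / 3
  rw [realify_fourierGL, baseRoot]
  ext i
  fin_cases i <;> simp [h3]

lemma fourierGL_sq_baseRoot : realify fourierGL (realify fourierGL baseRoot) = -baseRoot := by
  rw [fourierGL_baseRoot, fourierGL_table.1, Pi.single_neg]; rfl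

/-- The Fourier matrix joins the two families of roots, diagonal matrices and shifts move within
each, and the square of the Fourier matrix supplies the sign. -/
lemma exists_baseRoot_eq {a : V} (ha : a ∈ realRoots) :
    ∃ g ∈ hessianGroup, realify g baseRoot = a := by
  have sign : ∀ e : ℂ, (e = 1 ∨ e = -1) → ∃ g ∈ hessianGroup, realify g baseRoot = e • baseRoot := by
    rintro _ (rfl | rfl)
    · exact ⟨1, one_mem _, by simp⟩
    · exact ⟨fourierGL * fourierGL, mul_mem fourierGL_mem fourierGL_mem, by
        rw [map_mul, LinearEquiv.mul_apply, fourierGL_sq_baseRoot]; simp⟩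
  have shift : ∀ i, ∃ g ∈ hessianGroup, ∀ z, realify g (Pi.single 0 z) = Pi.single i z := by
    intro i
    fin_cases i
    · exact ⟨1, one_mem _, by simp⟩
    · exact ⟨shiftGL * shiftGL, mul_mem shiftGL_mem shiftGL_mem, fun z => by
        rw [map_mul, LinearEquiv.mul_apply, shiftGL_single, shiftGL_single]; rfl⟩
    · exact ⟨shiftGL, shiftGL_mem, fun z => by rw [shiftGL_single]; rfl⟩
  rcases (mem_realRoots_iff a).1 ha with ⟨c, hc, h⟩ | ⟨i, u, hu, rfl⟩
  · have : ∃ e : ℂ, (e = 1 ∨ e = -1) ∧ a = e • c := by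
      rcases h with rfl | rfl
      · exact ⟨1, .inl rfl, by simp⟩
      · exact ⟨-1, .inr rfl, by simp⟩
    obtain ⟨e, he, rfl⟩ := this
    obtain ⟨g, hg, hge⟩ := sign e he
    refine ⟨diagGL c hc * fourierGL * g,
      mul_mem (mul_mem (diagGL_mem c hc) fourierGL_mem) hg, ?_⟩
    rw [map_mul, LinearEquiv.mul_apply, hge, realify_smul, map_mul, LinearEquiv.mul_apply,
      fourierGL_baseRoot, realify_diagGL]
    congr 1
    ext i; fin_cases i <;> simp
  · have : ∃ e c : ℂ, (e = 1 ∨ e = -1) ∧ c ^ 3 = 1 ∧ u = c * e := by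
      rcases (sixth_iff u).1 hu with h | h
      · exact ⟨1, u, .inl rfl, h, by simp⟩
      · exact ⟨-1, -u, .inr rfl, h, by simp⟩
    obtain ⟨e, c, he, hc, rfl⟩ := this
    obtain ⟨g, hg, hge⟩ := sign e he
    obtain ⟨s, hs, hsi⟩ := shift i
    have hc' : ∀ i : Fin 3, (fun _ => c : V) i ^ 3 = 1 := fun _ => hc
    refine ⟨diagGL _ hc' * s * g, mul_mem (mul_mem (diagGL_mem _ _) hs) hg, ?_⟩
    rw [map_mul, LinearEquiv.mul_apply, hge, realify_smul, map_mul, LinearEquiv.mul_apply, baseRoot,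
      hsi, realify_diagGL]
    ext j
    by_cases hj : j = i
    · subst hj; simp; ring
    · simp [hj]

/-! ### Real reflections -/

/-- The orthogonal reflection negating `a`. -/
def rrefl (a : V) : V ≃ₗ[ℝ] V :=
  LinearEquiv.ofInvolutive
    { toFun := fun x => x - (2 * (hdot x a).re / (hdot a a).re) • a
      map_add' := fun x y => by
        rw [hdot_add_left, Complex.add_re, mul_add, add_div, add_smul]; abel
      map_smul' := fun c x => by
        rw [hdot_real_smul_left, Complex.re_ofReal_mul, RingHom.id_apply, smul_sub, smul_smul]
        congr 2; ring }
    (fun x => by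
      simp only [LinearMap.coe_mk, AddHom.coe_mk, hdot_sub_left, hdot_real_smul_left,
        Complex.sub_re, Complex.re_ofReal_mul]
      rw [sub_sub, ← add_smul, sub_eq_self]
      rcases eq_or_ne (hdot a a).re 0 with h | h
      · simp [h]
      · convert zero_smul ℝ a
        field_simp
        ring)

lemma rrefl_apply (a x : V) : rrefl a x = x - (2 * (hdot x a).re / (hdot a a).re) • a := rfl

lemma rrefl_apply_of_mem {a : V} (ha : a ∈ realRoots) (x : V) :
    rrefl a x = x - (2 / 3 * (hdot x a).re) • a := by
  rw [rrefl_apply, hdot_self_of_mem ha]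
  congr 2
  norm_num
  ring

lemma rrefl_mul_self (a : V) : rrefl a * rrefl a = 1 := by
  ext1 x
  exact (rrefl a).symm_apply_apply x

lemma rrefl_inv (a : V) : (rrefl a)⁻¹ = rrefl a := inv_eq_of_mul_eq_one_left (rrefl_mul_self a)

lemma realReflections_eq : realReflections = rrefl '' realRoots := by
  ext s
  constructor
  · rintro ⟨a, ha, h⟩
    exact ⟨a, ha, by ext1 x; rw [h, rrefl_apply]⟩
  · rintro ⟨a, ha, rfl⟩
    exact ⟨a, ha, rrefl_apply a⟩

lemma rrefl_mem {a : V} (ha : a ∈ realRoots) : rrefl a ∈ realReflectionGroup :=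
  Subgroup.subset_closure (realReflections_eq ▸ ⟨a, ha, rfl⟩)

lemma rrefl_neg (a : V) : rrefl (-a) = rrefl a := by
  ext1 x
  have h : hdot (-a) a = -hdot a a := by simp [hdot_eq]; ring
  rw [rrefl_apply, rrefl_apply, hdot_neg_right, hdot_neg_right, h]
  simp [neg_div]

lemma rrefl_conj {g : V ≃ₗ[ℝ] V} (hg : g ∈ rootAut) (a : V) :
    rrefl (g a) = g * rrefl a * g⁻¹ := by
  rw [eq_mul_inv_iff_mul_eq]
  ext1 x
  simp only [LinearEquiv.mul_apply, rrefl_apply, hg.2.2, map_sub, map_smul]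

/-- Since t is purely imaginary, negating the real direction of t in one coordinate is complex
conjugation there. -/
lemma rrefl_single (i : Fin 3) (x : V) :
    rrefl (Pi.single i t) x = Function.update x i (star (x i)) := by
  have h3 : √3 * √3 = 3 := Real.mul_self_sqrt (by norm_num)
  have hm : (Pi.single i t : V) ∈ realRoots := by
    simpa using single_mem_realRoots i (u := 1) (by simp)
  rw [rrefl_apply_of_mem hm, hdot_single_right, star_t]
  ext j
  by_cases hj : j = i
  · subst hj
    apply Complex.ext
    · simp [t_re, t_im]
    · simp [t_re, t_im]
      linear_combination (-2 / 3) * (x j).im * h3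
  · simp [hj]

lemma det_rrefl {a : V} (ha : a ∈ realRoots) : LinearEquiv.det (rrefl a) = -1 := by
  let f : Module.Dual ℝ V :=
    { toFun := fun x => -(2 / 3 * (hdot x a).re)
      map_add' := fun x y => by rw [hdot_add_left, Complex.add_re]; ring
      map_smul' := fun c x => by
        rw [hdot_real_smul_left, Complex.re_ofReal_mul, RingHom.id_apply, smul_eq_mul]; ring }
  have h : ((rrefl a : V ≃ₗ[ℝ] V) : V →ₗ[ℝ] V) = LinearMap.transvection f a := by
    refine LinearMap.ext fun x => ?_
    rw [LinearMap.transvection.apply, LinearEquiv.coe_coe, rrefl_apply_of_mem ha, sub_eq_add_neg,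
      ← neg_smul]
    rfl
  apply Units.ext
  rw [LinearEquiv.coe_det, h, LinearMap.transvection.det]
  change 1 + -(2 / 3 * (hdot a a).re) = _
  rw [hdot_self_of_mem ha]
  norm_num

lemma rrefl_baseRoot_mem_rootAut : rrefl baseRoot ∈ rootAut := by
  apply mem_rootAut_of_mapsTo
  · intro x hx
    rw [baseRoot, rrefl_single]
    rcases (mem_realRoots_iff x).1 hx with ⟨c, hc, h⟩ | ⟨i, u, hu, rfl⟩
    · have : Function.update c 0 (star (c 0)) ∈ realRoots := by
        refine vec_mem_realRoots fun i => ?_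
        by_cases hi : i = 0
        · subst hi; rw [Function.update_self, star_cube (hc 0)]
        · rw [Function.update_of_ne hi, hc]
      rcases h with rfl | rfl
      · exact this
      · rw [Pi.neg_apply, star_neg, Function.update_neg]
        exact neg_mem_realRoots this
    · by_cases hi : i = 0
      · subst hi
        have : (Function.update (Pi.single 0 (u * t)) 0 (star ((Pi.single 0 (u * t) : V) 0)) : V) =
            Pi.single 0 (-star u * t) := by
          rw [Pi.single_eq_same, star_mul, star_t, Pi.single, Function.update_idem, Pi.single]
          congr 1; ring
        rw [this]
        exact single_mem_realRoots _ (neg_sixth (by rw [← star_pow, hu, star_one]))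
      · rw [Pi.single_eq_of_ne' hi, star_zero, Function.update_eq_self_iff.2
          (by rw [Pi.single_eq_of_ne' hi])]
        exact single_mem_realRoots _ hu
  · rintro x ⟨i, c, d, hc, hd, rfl⟩
    rw [baseRoot, rrefl_single]
    fin_cases i
    · refine ⟨0, star c, d, star_cube hc, hd, ?_⟩
      ext j; fin_cases j <;> simp
    · refine ⟨1, c, d, hc, hd, ?_⟩
      ext j; fin_cases j <;> simp
    · refine ⟨2, c, star d, hc, star_cube hd, ?_⟩
      ext j; fin_cases j <;> simp
  · intro x y
    rw [baseRoot, rrefl_single, rrefl_single]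
    simp [hdot_eq]

lemma rrefl_mem_rootAut {a : V} (ha : a ∈ realRoots) : rrefl a ∈ rootAut := by
  obtain ⟨g, hg, rfl⟩ := exists_baseRoot_eq ha
  have hg' := hessianGroup_le_rootAut hg
  rw [rrefl_conj hg']
  exact mul_mem (mul_mem hg' rrefl_baseRoot_mem_rootAut) (inv_mem hg')

lemma realReflectionGroup_le_rootAut : realReflectionGroup ≤ rootAut := by
  rw [realReflectionGroup, Subgroup.closure_le, realReflections_eq]
  rintro _ ⟨a, ha, rfl⟩
  exact rrefl_mem_rootAut ha

/-! ### Complex reflections -/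

/-- The imaginary part of the form at x is recovered from the real part at ix, and g commutes with
i. -/
lemma hdot_realify {g : GL (Fin 3) ℂ} (hg : realify g ∈ rootAut) (x y : V) :
    hdot (realify g x) (realify g y) = hdot x y := by
  apply Complex.ext
  · exact hg.2.2 x y
  · have := hg.2.2 (Complex.I • x) y
    rw [realify_smul, hdot_smul_left, hdot_smul_left] at this
    simpa using this

lemma diagGL_single_apply {lam : ℂ} (h : ∀ i, (Pi.mulSingle 0 lam : V) i ^ 3 = 1) (x : V) :
    realify (diagGL (Pi.mulSingle 0 lam) h) x =
      x - (hdot x baseRoot / hdot baseRoot baseRoot * (1 - lam)) • baseRoot := by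
  rw [realify_diagGL, hdot_self_of_mem baseRoot_mem, baseRoot, hdot_single_right, star_t]
  ext j
  fin_cases j
  · simp
    linear_combination - x 0 * (1 - lam) / 3 * t_mul_t
  · simp
  · simp

lemma mulSingle_cube (i : Fin 3) {lam : ℂ} (hl : lam ^ 3 = 1) (j : Fin 3) :
    (Pi.mulSingle i lam : V) j ^ 3 = 1 := by
  by_cases hj : j = i
  · subst hj; simp [hl]
  · simp [hj]

/-- By transitivity this is a conjugate of diag(`lam`, 1, 1), the case of the base root. -/
lemma exists_complexReflection {r : V} (hr : r ∈ realRoots) {lam : ℂ} (hl : lam ^ 3 = 1) :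
    ∃ g ∈ hessianGroup, ∀ x, realify g x = x - (hdot x r / hdot r r * (1 - lam)) • r := by
  obtain ⟨g, hg, rfl⟩ := exists_baseRoot_eq hr
  refine ⟨g * diagGL _ (mulSingle_cube 0 hl) * g⁻¹,
    mul_mem (mul_mem hg (diagGL_mem _ _)) (inv_mem hg), fun x => ?_⟩
  obtain ⟨y, rfl⟩ := (realify g).surjective x
  have h1 : realify g⁻¹ (realify g y) = y := by
    rw [← LinearEquiv.mul_apply, ← map_mul, inv_mul_cancel, map_one]; rfl
  rw [map_mul, LinearEquiv.mul_apply, h1, map_mul, LinearEquiv.mul_apply, diagGL_single_apply,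
    map_sub, realify_smul, hdot_realify (hessianGroup_le_rootAut hg),
    hdot_realify (hessianGroup_le_rootAut hg)]

lemma cube_of_mem {lam : ℂ} (h : lam ∈ ({v, w} : Set ℂ)) : lam ^ 3 = 1 := by
  rcases h with rfl | rfl
  · exact v_cube
  · exact w_cube

lemma complexReflections_subset : complexReflections ⊆ hessianGroup := by
  rintro g ⟨r, hr, lam, hl, h⟩
  obtain ⟨g', hg', h'⟩ := exists_complexReflection (mirrorVectors_subset hr) (cube_of_mem hl)
  have : g = g' := by
    apply realify_injective
    ext1 x
    rw [h', ← h]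
    rfl
  exact this ▸ hg'

lemma closure_complexReflections : Subgroup.closure complexReflections = hessianGroup := by
  apply le_antisymm ((Subgroup.closure_le _).2 complexReflections_subset)
  have hd : ∀ c hc, diagGL c hc ∈ Subgroup.closure complexReflections := by
    refine diagGL_mem_of fun i h => Subgroup.subset_closure ?_
    have hm : Pi.single i t ∈ mirrorVectors := by
      have : ∀ i, (Pi.single i t : V) = ![t, 0, 0] ∨ (Pi.single i t : V) = ![0, t, 0] ∨
          (Pi.single i t : V) = ![0, 0, t] := by
        intro i; fin_cases i
        · left; ext j; fin_cases j <;> simp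
        · right; left; ext j; fin_cases j <;> simp
        · right; right; ext j; fin_cases j <;> simp
      rcases this i with h | h | h <;> rw [h] <;> simp [mirrorVectors]
    refine ⟨_, hm, v, by simp, fun x => ?_⟩
    rw [← realify_apply, realify_diagGL, hdot_self_of_mem (mirrorVectors_subset hm),
      hdot_single_right, star_t]
    ext j
    by_cases hj : j = i
    · subst hj; simp
      linear_combination - x j * (1 - v) / 3 * t_mul_t
    · simp [hj]
  have hf : fourierGL ∈ Subgroup.closure complexReflections := by
    have hm : ![1, 1, 1] ∈ mirrorVectors := by simp [mirrorVectors]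
    obtain ⟨g, -, hg⟩ := exists_complexReflection (mirrorVectors_subset hm) v_cube
    have hgm : g ∈ Subgroup.closure complexReflections :=
      Subgroup.subset_closure ⟨_, hm, v, by simp, hg⟩
    have h1 : ∀ i, (![w, v, v] : V) i ^ 3 = 1 := by intro i; fin_cases i <;> simp [v_cube, w_cube]
    have h2 : ∀ i, (![1, w, w] : V) i ^ 3 = 1 := by intro i; fin_cases i <;> simp [w_cube]
    -- The Fourier matrix factors as diag(w, v, v) · R · diag(1, w, w), with R the reflection in (1,
    -- 1, 1) with eigenvalue v.
    convert mul_mem (mul_mem (hd _ h1) hgm) (hd _ h2) using 1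
    apply realify_injective
    ext1 x
    rw [map_mul, LinearEquiv.mul_apply, map_mul, LinearEquiv.mul_apply, hg, realify_diagGL,
      realify_diagGL, hdot_self_of_mem (mirrorVectors_subset hm), realify_fourierGL, vec3_mul,
      vec3_mul, w_eq, t_eq]
    clear hg hgm hd hm h1 h2
    have h := v_sq
    ext j
    fin_cases j <;> simp [hdot_eq] <;> grind
  refine hessianGroup_le hd ?_ hf
  have h1 : ∀ i, (![1, w, v] : V) i ^ 3 = 1 := by intro i; fin_cases i <;> simp [v_cube, w_cube]
  -- The Fourier matrix diagonalizes the cyclic shift, with eigenvalues 1, w, v.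
  convert mul_mem (inv_mem hf) (mul_mem (hd _ h1) hf) using 1
  rw [eq_inv_mul_iff_mul_eq]
  apply realify_injective
  ext1 x
  rw [map_mul, LinearEquiv.mul_apply, map_mul, LinearEquiv.mul_apply, realify_shiftGL,
    realify_fourierGL, realify_diagGL, realify_fourierGL, mul_smul_comm, vec3_mul, w_eq]
  clear hd hf h1
  have h := v_sq
  ext j
  fin_cases j <;> simp <;> grind

/-- Complex reflections are products of two real reflections. -/
lemma realify_complexReflection {r : V} (hr : r ∈ realRoots) {lam : ℂ} (hl : lam ^ 3 = 1)
    {g : GL (Fin 3) ℂ} (hg : ∀ x, realify g x = x - (hdot x r / hdot r r * (1 - lam)) • r) :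
    realify g = rrefl (lam ^ 2 • r) * rrefl r := by
  have hr3 := hdot_self_of_mem hr
  have hl2 : (lam ^ 2) ^ 6 = 1 := by rw [← pow_mul, show 2 * 6 = 3 * 4 by rfl, pow_mul, hl, one_pow]
  ext1 x
  have hre : ∀ z : ℂ, ((z.re : ℝ) : ℂ) = (z + star z) / 2 := fun z => Complex.re_eq_add_conj z
  have hs : ∀ (z : ℝ) (y : V), z • y = (z : ℂ) • y := fun z y => (Complex.coe_smul z y).symm
  -- On the line of multiples zr, the reflection negating ur is z ↦ -u²z̄. Composing those for u =
  -- `lam`² and u = 1 multiplies z by `lam`⁴ = `lam`; the Hermitian complement is fixed.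
  rw [hg, LinearEquiv.mul_apply, rrefl_apply_of_mem hr,
    rrefl_apply_of_mem (smul_mem_realRoots hr hl2), hdot_smul_right, hdot_sub_left,
    hdot_real_smul_left, hr3, hs, hs, smul_smul, sub_sub, ← add_smul]
  congr 2
  have h1 := star_mul_self_of_cube hl
  push_cast
  simp only [hre, star_mul, star_sub, star_add, star_pow, star_div₀, star_ofNat, Complex.star_def]
  simp only [Complex.star_def] at h1
  generalize hdot x r = z
  have h2 : (starRingEnd ℂ) lam = lam ^ 2 := by
    linear_combination lam ^ 2 * h1 - (starRingEnd ℂ) lam * hl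
  simp only [map_pow, h2, Complex.conj_conj]
  generalize (starRingEnd ℂ) z = z'
  clear h1 h2 hs hre hg hr3 hl2
  grind

lemma realify_hessianGroup_le : hessianGroup ≤ realReflectionGroup.comap realify := by
  rw [← closure_complexReflections, Subgroup.closure_le]
  rintro g ⟨r, hr, lam, hl, h⟩
  have hm := mirrorVectors_subset hr
  have hl2 : (lam ^ 2) ^ 6 = 1 := by
    rw [← pow_mul, show 2 * 6 = 3 * 4 by rfl, pow_mul, cube_of_mem hl, one_pow]
  rw [SetLike.mem_coe, Subgroup.mem_comap, realify_complexReflection hm (cube_of_mem hl) h]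
  exact mul_mem (rrefl_mem (smul_mem_realRoots hm hl2)) (rrefl_mem hm)

lemma det_hessianGroup {g : GL (Fin 3) ℂ} (hg : g ∈ hessianGroup) :
    LinearEquiv.det (realify g) = 1 := by
  suffices hessianGroup ≤ (LinearEquiv.det : (V ≃ₗ[ℝ] V) →* ℝˣ).ker.comap realify from this hg
  rw [← closure_complexReflections, Subgroup.closure_le]
  rintro g ⟨r, hr, lam, hl, h⟩
  have hm := mirrorVectors_subset hr
  have hl2 : (lam ^ 2) ^ 6 = 1 := by
    rw [← pow_mul, show 2 * 6 = 3 * 4 by rfl, pow_mul, cube_of_mem hl, one_pow]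
  rw [SetLike.mem_coe, Subgroup.mem_comap, MonoidHom.mem_ker,
    realify_complexReflection hm (cube_of_mem hl) h, map_mul, det_rrefl hm,
    det_rrefl (smul_mem_realRoots hm hl2)]
  norm_num

/-! ### The stabilizer of a root and the order of the Hessian group -/

lemma realify_eq_sum (g : GL (Fin 3) ℂ) (x : V) :
    realify g x = ∑ i, (x i / t) • realify g (Pi.single i t) := by
  have : x = ∑ i, (x i / t) • (Pi.single i t : V) := by
    ext j
    rw [Fin.sum_univ_three]
    have := t_ne_zero
    fin_cases j <;> simp <;> field_simp
  conv_lhs => rw [this]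
  rw [map_sum]
  simp only [realify_smul]

lemma single_t_mem (i : Fin 3) : (Pi.single i t : V) ∈ realRoots := by
  simpa using single_mem_realRoots i (u := 1) (by simp)

lemma smul_t_injective {x y : V} (h : t • x = t • y) : x = y := smul_right_injective V t_ne_zero h

/-- The Hermitian complement of the base root is preserved, and the roots in it lie on the other two
axes, so `g` is monomial. The image of (1, 1, 1) is a root with first coordinate 1, which forces the
entries to be cube roots of unity. -/
lemma eq_diagGL_of_fixes_baseRoot {g : GL (Fin 3) ℂ} (hg : realify g ∈ rootAut)
    (hb : realify g baseRoot = baseRoot) : ∃ c hc, c 0 = 1 ∧ g = diagGL c hc := by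
  have ht := t_ne_zero
  have hsingle : ∀ j : Fin 3, j ≠ 0 → ∃ i u, i ≠ 0 ∧ realify g (Pi.single j t) =
      Pi.single i (u * t) := by
    intro j hj
    have h0 : realify g (Pi.single j t) 0 = 0 := by
      have := hdot_realify hg (Pi.single j t) baseRoot
      rw [hb, baseRoot, hdot_single_right, hdot_single_right, Pi.single_eq_of_ne hj.symm, zero_mul,
        star_t] at this
      simpa [ht] using this
    rcases (mem_realRoots_iff _).1 ((hg.1 _).2 (single_t_mem j)) with ⟨c, hc, h⟩ | ⟨i, u, hu, h⟩
    · have := ne_zero_of_cube (hc 0)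
      rcases h with h | h <;> rw [h] at h0 <;> simp [this] at h0
    · refine ⟨i, u, ?_, h⟩
      rintro rfl
      rw [h] at h0
      simp [ht, ne_zero_of_sixth hu] at h0
  obtain ⟨i, a, hi, ha⟩ := hsingle 1 (by decide)
  obtain ⟨j, b, hj, hb'⟩ := hsingle 2 (by decide)
  have hsum : t • realify g ![1, 1, 1] =
      Pi.single 0 t + Pi.single i (a * t) + Pi.single j (b * t) := by
    have : t • (![1, 1, 1] : V) = baseRoot + Pi.single 1 t + Pi.single 2 t := by
      ext k; fin_cases k <;> simp [baseRoot]
    rw [← realify_smul, this, map_add, map_add, hb, ha, hb', baseRoot]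
  have hmem : realify g ![1, 1, 1] ∈ realRoots :=
    (hg.1 _).2 (vec_mem_realRoots fun i => by fin_cases i <;> simp)
  have h1 : realify g ![1, 1, 1] 0 = 1 := by
    have := congrFun hsum 0
    rw [Pi.smul_apply, Pi.add_apply, Pi.add_apply, Pi.single_eq_same, Pi.single_eq_of_ne hi.symm,
      Pi.single_eq_of_ne hj.symm, smul_eq_mul] at this
    exact mul_left_cancel₀ ht (by rw [this]; ring)
  have hc : ∀ k, realify g ![1, 1, 1] k ^ 3 = 1 := by
    rcases (mem_realRoots_iff _).1 hmem with ⟨c, hc, h | h⟩ | ⟨k, u, hu, h⟩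
    · rw [h]; exact hc
    · rw [h, Pi.neg_apply] at h1
      exact absurd h1.symm (cube_not_neg (one_pow 3) (hc 0))
    · exfalso
      have hk : (Pi.single k (u * t) : V) 0 = 1 := by rw [← h]; exact h1
      have hk0 : k = 0 := by
        by_contra hk0
        rw [Pi.single_eq_of_ne' hk0] at hk
        norm_num at hk
      subst hk0
      rw [Pi.single_eq_same] at hk
      have h6 : (u * t) ^ 6 = -27 := by
        rw [mul_pow, hu, show t ^ 6 = (t ^ 2) ^ 3 by ring, t_sq]; norm_num
      rw [hk] at h6
      norm_num at h6
  set c := realify g ![1, 1, 1] with hcdef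
  have hij : (i = 1 ∧ j = 2) ∨ (i = 2 ∧ j = 1) := by
    have e1 := congrFun hsum 1
    have e2 := congrFun hsum 2
    have n1 := ne_zero_of_cube (hc 1)
    have n2 := ne_zero_of_cube (hc 2)
    fin_cases i <;> fin_cases j <;> simp at hi hj e1 e2 ⊢ <;> tauto
  rcases hij with ⟨rfl, rfl⟩ | ⟨rfl, rfl⟩
  · have e1 : t * c 1 = a * t := by simpa using congrFun hsum 1
    have e2 : t * c 2 = b * t := by simpa using congrFun hsum 2
    have e1' : a = c 1 := mul_right_cancel₀ ht (by rw [← e1]; ring)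
    have e2' : b = c 2 := mul_right_cancel₀ ht (by rw [← e2]; ring)
    refine ⟨c, hc, h1, ?_⟩
    apply realify_injective
    ext1 x
    rw [baseRoot] at hb
    rw [realify_diagGL, realify_eq_sum, Fin.sum_univ_three, hb, ha, hb', e1', e2']
    ext k
    fin_cases k
    · simp [h1, ht]
    · simp; field_simp
    · simp; field_simp
  -- The swapped case preserves the roots and is excluded only by the weights: the image of e₁ - e₂
  -- has its signs in the wrong cyclic order.
  · exfalso
    have e1 : t * c 1 = b * t := by simpa using congrFun hsum 1
    have e2 : t * c 2 = a * t := by simpa using congrFun hsum 2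
    have hw : (Pi.single 1 1 - Pi.single 2 1 : V) ∈ weights :=
      ⟨1, 1, 1, by simp, by simp, by congr⟩
    have hw' := (hg.2.1 _).2 hw
    have : realify g (Pi.single 1 1 - Pi.single 2 1) = Pi.single 2 (c 2) - Pi.single 1 (c 1) := by
      apply smul_t_injective
      rw [← realify_smul, smul_sub, ← Pi.single_smul, ← Pi.single_smul, smul_eq_mul, mul_one,
        map_sub, ha, hb', smul_sub, ← Pi.single_smul, ← Pi.single_smul, smul_eq_mul, smul_eq_mul,
        e1, e2]
    rw [this] at hw'
    obtain ⟨k, p, q, hp, hq, h⟩ := hw'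
    have p0 := ne_zero_of_cube hp
    have q0 := ne_zero_of_cube hq
    fin_cases k
    · exact p0 (by simpa using (congrFun h 0).symm)
    · exact cube_not_neg hp (hc 1) (by simpa using (congrFun h 1).symm)
    · exact q0 (by simpa using (congrFun h 0).symm)

lemma mem_hessianGroup_of_mem_rootAut {g : GL (Fin 3) ℂ} (hg : realify g ∈ rootAut) :
    g ∈ hessianGroup := by
  obtain ⟨h, hh, hb⟩ := exists_baseRoot_eq ((hg.1 _).2 baseRoot_mem)
  have h1 : realify (h⁻¹ * g) ∈ rootAut := by
    rw [map_mul]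
    exact mul_mem (hessianGroup_le_rootAut (inv_mem hh)) hg
  have h2 : realify (h⁻¹ * g) baseRoot = baseRoot := by
    rw [map_mul, LinearEquiv.mul_apply, ← hb, ← LinearEquiv.mul_apply, ← map_mul, inv_mul_cancel,
      map_one]
    rfl
  obtain ⟨c, hc, -, h3⟩ := eq_diagGL_of_fixes_baseRoot h1 h2
  have := mul_mem hh (h3 ▸ diagGL_mem c hc : h⁻¹ * g ∈ hessianGroup)
  rwa [mul_inv_cancel_left] at this

lemma cubes_eq : {x : ℂ | x ^ 3 = 1} = {1, v, w} := by
  ext x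
  simp [cube_eq_one_iff]

lemma ncard_cubes : {x : ℂ | x ^ 3 = 1}.ncard = 3 :=
  Set.ncard_eq_three.2 ⟨1, v, w, v_ne_one.symm, w_ne_one.symm, v_ne_w, cubes_eq⟩

lemma ncard_sixths : {x : ℂ | x ^ 6 = 1}.ncard = 6 := by
  have h : {x : ℂ | x ^ 6 = 1} = {x : ℂ | x ^ 3 = 1} ∪ Neg.neg '' {x : ℂ | x ^ 3 = 1} := by
    ext x
    simp [sixth_iff]
  rw [h, Set.ncard_union_eq _ finite_cubes (finite_cubes.image _),
    Set.ncard_image_of_injective _ neg_injective, ncard_cubes]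
  rw [Set.disjoint_left]
  rintro x hx ⟨y, hy, rfl⟩
  exact cube_not_neg hx hy rfl

/-! ### Eisenstein integer coordinates -/

/-- The Eisenstein integer with coordinates `p`. -/
def eis (p : ℤ × ℤ) : ℂ := p.1 + p.2 * v

/-- Multiplication of Eisenstein integers. -/
def eisMul (p q : ℤ × ℤ) : ℤ × ℤ :=
  (p.1 * q.1 - p.2 * q.2, p.1 * q.2 + p.2 * q.1 - p.2 * q.2)

lemma eis_mul (p q : ℤ × ℤ) : eis p * eis q = eis (eisMul p q) := by
  simp only [eis, eisMul]
  push_cast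
  linear_combination (p.2 : ℂ) * q.2 * v_sq

lemma eis_injective : Function.Injective eis := by
  rintro ⟨a, b⟩ ⟨c, d⟩ h
  have him := congrArg Complex.im h
  have hre := congrArg Complex.re h
  simp [eis, v_im, v_re] at him hre
  subst him
  simpa using hre

/-- The vectors of `mirrorVectors` in Eisenstein integer coordinates. -/
def mirrorCoords : Fin 12 → Fin 3 → ℤ × ℤ :=
  ![![(1, 2), 0, 0], ![(1, 0), (1, 0), (1, 0)], ![(0, 1), (1, 0), (1, 0)],
    ![(-1, -1), (1, 0), (1, 0)], ![0, (1, 2), 0], ![(1, 0), (0, 1), (-1, -1)],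
    ![(1, 0), (1, 0), (0, 1)], ![(1, 0), (-1, -1), (1, 0)], ![0, 0, (1, 2)],
    ![(1, 0), (-1, -1), (0, 1)], ![(1, 0), (0, 1), (1, 0)], ![(1, 0), (1, 0), (-1, -1)]]

lemma eis_zero : eis 0 = 0 := by simp [eis]

lemma eis_one : eis (1, 0) = 1 := by simp [eis]

lemma eis_v : eis (0, 1) = v := by simp [eis]

lemma eis_w : eis (-1, -1) = w := by simp [eis, w_eq]; ring

lemma eis_t : eis (1, 2) = t := by simp [eis, t_eq]

lemma eis_vec (p q r : ℤ × ℤ) : eis ∘ ![p, q, r] = ![eis p, eis q, eis r] := by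
  ext i; fin_cases i <;> simp

lemma mirrorVectors_eq_range : mirrorVectors = Set.range fun n => eis ∘ mirrorCoords n := by
  ext x
  simp only [Set.mem_range, Fin.exists_fin_succ, mirrorVectors, Set.mem_insert_iff,
    Set.mem_singleton_iff]
  simp [mirrorCoords, eis_vec, eis_zero, eis_one, eis_v, eis_w, eis_t, eq_comm]

/-- Proportionality is tested by vanishing 2 × 2 minors, a finite check over the Eisenstein
integers. -/
lemma mirrorCoords_parallel : ∀ m n : Fin 12,
    (∀ i j, eisMul (mirrorCoords m i) (mirrorCoords n j) =
      eisMul (mirrorCoords m j) (mirrorCoords n i)) → m = n := by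
  decide +kernel

lemma mirror_parallel {r r' : V} (hr : r ∈ mirrorVectors) (hr' : r' ∈ mirrorVectors) {a b : ℂ}
    (ha : a ≠ 0) (h : a • r = b • r') : r = r' := by
  rw [mirrorVectors_eq_range] at hr hr'
  obtain ⟨m, rfl⟩ := hr
  obtain ⟨n, rfl⟩ := hr'
  rw [mirrorCoords_parallel m n]
  intro i j
  apply eis_injective
  rw [← eis_mul, ← eis_mul]
  have hi : a * eis (mirrorCoords m i) = b * eis (mirrorCoords n i) := congrFun h i
  have hj : a * eis (mirrorCoords m j) = b * eis (mirrorCoords n j) := congrFun h j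
  apply mul_left_cancel₀ ha
  linear_combination eis (mirrorCoords n j) * hi - eis (mirrorCoords n i) * hj

/-! ### Counting mirrors, roots, reflections and group elements. -/

lemma ncard_mirrorVectors : mirrorVectors.ncard = 12 := by
  rw [mirrorVectors_eq_range, ← Set.image_univ, Set.ncard_image_of_injective, Set.ncard_univ,
    Nat.card_fin]
  intro m n h
  apply mirrorCoords_parallel
  intro i j
  apply eis_injective
  rw [← eis_mul, ← eis_mul]
  have hi : eis (mirrorCoords m i) = eis (mirrorCoords n i) := congrFun h i
  have hj : eis (mirrorCoords m j) = eis (mirrorCoords n j) := congrFun h j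
  rw [hi, hj, mul_comm]

lemma ncard_mirrors : mirrors.ncard = 12 := by
  rw [mirrors, Set.InjOn.ncard_image, ncard_mirrorVectors]
  intro r hr r' hr' h
  have : r ∈ Submodule.span ℂ {r'} := by
    change Submodule.span ℂ {r} = Submodule.span ℂ {r'} at h
    rw [← h]; exact Submodule.mem_span_singleton_self r
  obtain ⟨z, hz⟩ := Submodule.mem_span_singleton.1 this
  exact mirror_parallel hr hr' one_ne_zero (by rw [one_smul, hz])

lemma smul_cancel_of_mem {r : V} (hr : r ∈ realRoots) {a b : ℂ} (h : a • r = b • r) : a = b :=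
  smul_left_injective ℂ (ne_zero_of_mem_realRoots hr) h

lemma ncard_realRoots : realRoots.ncard = 72 := by
  have h : realRoots = (fun p : V × ℂ => p.2 • p.1) '' (mirrorVectors ×ˢ {u | u ^ 6 = 1}) := by
    ext a
    constructor
    · rintro ⟨r, hr, u, hu, rfl⟩
      exact ⟨(r, u), ⟨hr, hu⟩, rfl⟩
    · rintro ⟨⟨r, u⟩, ⟨hr, hu⟩, rfl⟩
      exact ⟨r, hr, u, hu, rfl⟩
  rw [h, Set.InjOn.ncard_image, Set.ncard_prod, ncard_mirrorVectors, ncard_sixths]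
  rintro ⟨r, u⟩ ⟨hr, hu⟩ ⟨r', u'⟩ ⟨hr', hu'⟩ h
  obtain rfl : r = r' := mirror_parallel hr hr' (ne_zero_of_sixth hu) h
  obtain rfl : u = u' := smul_cancel_of_mem (mirrorVectors_subset hr) h
  rfl

lemma ncard_complexReflections : complexReflections.ncard = 24 := by
  have h24 : (mirrorVectors ×ˢ ({v, w} : Set ℂ)).ncard = 24 := by
    rw [Set.ncard_prod, ncard_mirrorVectors, Set.ncard_pair v_ne_w]
  have hex : ∀ p ∈ mirrorVectors ×ˢ ({v, w} : Set ℂ), ∃ g : GL (Fin 3) ℂ, ∀ x,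
      realify g x = x - (hdot x p.1 / hdot p.1 p.1 * (1 - p.2)) • p.1 := by
    rintro ⟨r, lam⟩ ⟨hr, hl⟩
    obtain ⟨g, -, hg⟩ := exists_complexReflection (mirrorVectors_subset hr) (cube_of_mem hl)
    exact ⟨g, hg⟩
  choose f hf using hex
  rw [← h24]
  refine (Set.ncard_congr f ?_ ?_ ?_).symm
  · rintro ⟨r, lam⟩ ⟨hr, hl⟩
    exact ⟨r, hr, lam, hl, hf _ _⟩
  · rintro ⟨r, lam⟩ ⟨r', lam'⟩ hp hp' h
    have hr : r ∈ mirrorVectors := hp.1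
    have hr' : r' ∈ mirrorVectors := hp'.1
    have hl : lam ∈ ({v, w} : Set ℂ) := hp.2
    have hne : (1 : ℂ) - lam ≠ 0 := by
      rw [sub_ne_zero]
      rcases hl with rfl | rfl
      · exact v_ne_one.symm
      · exact w_ne_one.symm
    have h2 := hf _ hp r
    rw [h, hf _ hp', sub_right_inj] at h2
    have h3 : hdot r r / hdot r r * (1 - lam) = 1 - lam := by
      rw [hdot_self_of_mem (mirrorVectors_subset hr)]; norm_num
    simp only [h3] at h2
    obtain rfl : r = r' := mirror_parallel hr hr' hne h2.symm
    have h4 := smul_cancel_of_mem (mirrorVectors_subset hr) h2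
    rw [hdot_self_of_mem (mirrorVectors_subset hr), div_self (by norm_num), one_mul,
      sub_right_inj] at h4
    rw [h4]
  · rintro g ⟨r, hr, lam, hl, h⟩
    refine ⟨(r, lam), Set.mk_mem_prod hr hl, ?_⟩
    apply realify_injective
    ext1 x
    rw [hf, realify_apply, h]

lemma ncard_realReflections : realReflections.ncard = 36 := by
  have h : realReflections =
      (fun p : V × ℂ => rrefl (p.2 • p.1)) '' (mirrorVectors ×ˢ {u | u ^ 3 = 1}) := by
    rw [realReflections_eq]
    ext s
    constructor
    · rintro ⟨_, ⟨r, hr, u, hu, rfl⟩, rfl⟩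
      rcases (sixth_iff u).1 hu with hu | hu
      · exact ⟨(r, u), ⟨hr, hu⟩, rfl⟩
      · exact ⟨(r, -u), ⟨hr, hu⟩, by simp only [neg_smul, rrefl_neg]⟩
    · rintro ⟨⟨r, u⟩, ⟨hr, hu⟩, rfl⟩
      exact ⟨_, ⟨r, hr, u, sixth_of_cube hu, rfl⟩, rfl⟩
  rw [h, Set.InjOn.ncard_image, Set.ncard_prod, ncard_mirrorVectors, ncard_cubes]
  rintro ⟨r, c⟩ ⟨hr, hc⟩ ⟨r', c'⟩ ⟨hr', hc'⟩ h
  have hm : c • r ∈ realRoots := smul_mem_realRoots (mirrorVectors_subset hr) (sixth_of_cube hc)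
  have hm' : c' • r' ∈ realRoots :=
    smul_mem_realRoots (mirrorVectors_subset hr') (sixth_of_cube hc')
  have h1 : rrefl (c • r) (c • r) = rrefl (c' • r') (c • r) := by
    rw [show rrefl (c • r) = rrefl (c' • r') from h]
  rw [rrefl_apply_of_mem hm, rrefl_apply_of_mem hm', sub_right_inj, hdot_self_of_mem hm] at h1
  generalize (2 / 3 * (hdot (c • r) (c' • r')).re) = k at h1
  have h2 : (2 * c) • r = (k * c') • r' := by
    rw [mul_smul, mul_smul, Complex.coe_smul, ← h1, ← Complex.coe_smul]
    norm_num
  have hc0 := ne_zero_of_cube hc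
  obtain rfl : r = r' := mirror_parallel hr hr' (mul_ne_zero two_ne_zero hc0) h2
  have h3 := smul_cancel_of_mem (mirrorVectors_subset hr) h2
  -- Cubing removes the cube roots of unity; since `k` is real, `k` ^ 3 = 8 leaves only 2.
  have h4 : k = 2 := by
    have : (k : ℂ) ^ 3 = 8 := by
      have h5 : (2 * c) ^ 3 = (k * c') ^ 3 := by rw [h3]
      rw [mul_pow, mul_pow, hc, hc'] at h5
      linear_combination -h5
    have h5 : k ^ 3 = 2 ^ 3 := by
      norm_num
      exact_mod_cast this
    exact (Odd.strictMono_pow (by decide : Odd 3)).injective h5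
  subst h4
  push_cast at h3
  rw [mul_left_cancel₀ two_ne_zero h3]

lemma card_hessianGroup : Nat.card hessianGroup = 648 := by
  choose! f hf hfb using fun a (ha : a ∈ realRoots) => exists_baseRoot_eq ha
  have hc : ∀ p : ℂ × ℂ, p ∈ {x : ℂ | x ^ 3 = 1} ×ˢ {x : ℂ | x ^ 3 = 1} →
      ∀ i, (![1, p.1, p.2] : V) i ^ 3 = 1 := by
    rintro ⟨x, y⟩ ⟨hx, hy⟩ i
    have hx' : x ^ 3 = 1 := hx
    have hy' : y ^ 3 = 1 := hy
    fin_cases i <;> simp [hx', hy']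
  have hbase : ∀ x y h, realify (diagGL ![1, x, y] h) baseRoot = baseRoot := by
    intro x y h
    rw [realify_diagGL, vec3_mul, baseRoot]
    ext i; fin_cases i <;> simp
  -- Orbit and stabilizer: an element is determined by the image of the base root and by the two
  -- free entries of a diagonal matrix fixing it.
  have key : (realRoots ×ˢ {x : ℂ | x ^ 3 = 1} ×ˢ {x : ℂ | x ^ 3 = 1}).ncard =
      (hessianGroup : Set (GL (Fin 3) ℂ)).ncard := by
    refine Set.ncard_congr (fun q hq => f q.1 * diagGL _ (hc q.2 hq.2)) ?_ ?_ ?_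
    · rintro ⟨a, p⟩ hq
      exact mul_mem (hf a hq.1) (diagGL_mem _ _)
    · rintro ⟨a, x, y⟩ ⟨a', x', y'⟩ hq hq' h
      have h1 := congrArg (fun g => realify g baseRoot) h
      simp only [map_mul, LinearEquiv.mul_apply, hbase] at h1
      rw [hfb a hq.1, hfb a' hq'.1] at h1
      subst h1
      have h2 := congrArg (fun g => realify g ![1, 1, 1]) (mul_left_cancel h)
      simp only [realify_diagGL, vec3_mul] at h2
      have e1 := congrFun h2 1
      have e2 := congrFun h2 2
      simp at e1 e2
      rw [e1, e2]
    · intro g hg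
      have ha := ((hessianGroup_le_rootAut hg).1 _).2 baseRoot_mem
      have h1 : realify ((f (realify g baseRoot))⁻¹ * g) baseRoot = baseRoot := by
        rw [map_mul, LinearEquiv.mul_apply]
        nth_rewrite 2 [← hfb _ ha]
        rw [← LinearEquiv.mul_apply, ← map_mul, inv_mul_cancel, map_one]
        rfl
      obtain ⟨c, hc', h0, h2⟩ := eq_diagGL_of_fixes_baseRoot
        (hessianGroup_le_rootAut (mul_mem (inv_mem (hf _ ha)) hg)) h1
      refine ⟨(realify g baseRoot, c 1, c 2), ⟨ha, hc' 1, hc' 2⟩, ?_⟩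
      rw [inv_mul_eq_iff_eq_mul] at h2
      conv_rhs => rw [h2]
      congr 2
      ext i; fin_cases i <;> simp [h0]
  rw [Set.ncard_prod, Set.ncard_prod, ncard_realRoots, ncard_cubes] at key
  exact key.symm

/-! ### The root system of type `E₆` -/

lemma eis_add (p q : ℤ × ℤ) : eis (p + q) = eis p + eis q := by
  simp only [eis, Prod.fst_add, Prod.snd_add]; push_cast; ring

lemma eis_smul (n : ℤ) (p : ℤ × ℤ) : eis (n • p) = n * eis p := by
  simp only [eis, Prod.smul_fst, Prod.smul_snd, smul_eq_mul]; push_cast; ring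

/-- The sixth roots of unity in Eisenstein integer coordinates. -/
def unitCoords : Fin 6 → ℤ × ℤ := ![(1, 0), (0, 1), (-1, -1), (-1, 0), (0, -1), (1, 1)]

lemma eis_neg (p : ℤ × ℤ) : eis (-p) = -eis p := by
  simp only [eis, Prod.fst_neg, Prod.snd_neg]; push_cast; ring

lemma sixth_iff_unitCoords (u : ℂ) : u ^ 6 = 1 ↔ ∃ k, u = eis (unitCoords k) := by
  have h1 : eis (-1, 0) = -1 := by rw [← eis_one, ← eis_neg]; rfl
  have h2 : eis (0, -1) = -v := by rw [← eis_v, ← eis_neg]; rfl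
  have h3 : eis (1, 1) = -w := by rw [← eis_w, ← eis_neg]; rfl
  rw [sixth_iff, cube_eq_one_iff, cube_eq_one_iff]
  simp only [Fin.exists_fin_succ, unitCoords]
  simp [h1, h2, h3, eis_one, eis_v, eis_w, neg_eq_iff_eq_neg, or_assoc]

/-- The roots in Eisenstein integer coordinates. -/
def rootCoords (m : Fin 12) (k : Fin 6) (i : Fin 3) : ℤ × ℤ :=
  eisMul (unitCoords k) (mirrorCoords m i)

lemma mem_realRoots_iff_rootCoords (a : V) :
    a ∈ realRoots ↔ ∃ m k, a = eis ∘ rootCoords m k := by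
  have h : ∀ m k, eis ∘ rootCoords m k = eis (unitCoords k) • (eis ∘ mirrorCoords m) := by
    intro m k
    ext i
    exact (eis_mul _ _).symm
  constructor
  · rintro ⟨r, hr, u, hu, rfl⟩
    rw [mirrorVectors_eq_range] at hr
    obtain ⟨m, rfl⟩ := hr
    obtain ⟨k, rfl⟩ := (sixth_iff_unitCoords u).1 hu
    exact ⟨m, k, (h m k).symm⟩
  · rintro ⟨m, k, rfl⟩
    exact ⟨_, mirrorVectors_eq_range ▸ ⟨m, rfl⟩, _, (sixth_iff_unitCoords _).2 ⟨k, rfl⟩, h m k⟩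

/-- The simple roots in Eisenstein integer coordinates. -/
def simpleCoords : Fin 6 → Fin 3 → ℤ × ℤ :=
  ![![0, (-1, 1), 0], ![(1, -1), 0, 0], ![0, (2, 1), 0], ![(0, 1), (-1, -1), (-1, -1)],
    ![0, 0, (1, 2)], ![0, 0, (1, -1)]]

/-- The coefficients of a vector with respect to the simple roots. -/
def simpleCoeff (p : Fin 3 → ℤ × ℤ) : Fin 6 → ℤ :=
  -- Subscripts are one-based, with 4 the branch node. Adding the two Eisenstein coordinates of an
  -- entry kills simple roots 1, 2 and 6, leaving n₄, 3n₃ - 2n₄ and 3n₅ - 2n₄; on roots the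
  -- divisions are therefore exact.
  let n₄ := (p 0).1 + (p 0).2
  let n₃ := ((p 1).1 + (p 1).2 + 2 * n₄) / 3
  let n₅ := ((p 2).1 + (p 2).2 + 2 * n₄) / 3
  ![(p 1).2 + n₄ - n₃, (p 0).1, n₃, n₄, n₅, (p 2).1 + n₄ - n₅]

lemma simpleCoeff_spec : ∀ m k, (∀ i, rootCoords m k i =
      simpleCoeff (rootCoords m k) 0 • simpleCoords 0 i +
      simpleCoeff (rootCoords m k) 1 • simpleCoords 1 i +
      simpleCoeff (rootCoords m k) 2 • simpleCoords 2 i +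
      simpleCoeff (rootCoords m k) 3 • simpleCoords 3 i +
      simpleCoeff (rootCoords m k) 4 • simpleCoords 4 i +
      simpleCoeff (rootCoords m k) 5 • simpleCoords 5 i) ∧
    ((∀ j, 0 ≤ simpleCoeff (rootCoords m k) j) ∨ ∀ j, 0 ≤ -simpleCoeff (rootCoords m k) j) := by
  decide +kernel

lemma simpleCoords_mem : ∀ j, ∃ m k, simpleCoords j = rootCoords m k := by
  decide +kernel

/-- The simple roots. -/
def simpleRoot (j : Fin 6) : V := eis ∘ simpleCoords j

lemma simpleRoot_mem (j : Fin 6) : simpleRoot j ∈ realRoots := by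
  obtain ⟨m, k, h⟩ := simpleCoords_mem j
  exact (mem_realRoots_iff_rootCoords _).2 ⟨m, k, by rw [simpleRoot, h]⟩

lemma exists_int_coeff {a : V} (ha : a ∈ realRoots) :
    ∃ n : Fin 6 → ℤ, a = ∑ j, n j • simpleRoot j ∧ ((∀ j, 0 ≤ n j) ∨ ∀ j, 0 ≤ -n j) := by
  obtain ⟨m, k, rfl⟩ := (mem_realRoots_iff_rootCoords a).1 ha
  obtain ⟨h1, h2⟩ := simpleCoeff_spec m k
  refine ⟨_, ?_, h2⟩
  ext i
  rw [Function.comp_apply, h1 i]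
  simp only [eis_add, eis_smul, Fin.sum_univ_six, Pi.add_apply, Pi.smul_apply]
  simp only [zsmul_eq_mul, simpleRoot, Function.comp_apply]

lemma sum_mem_closure {n : Fin 6 → ℤ} (hn : ∀ j, 0 ≤ n j) :
    ∑ j, n j • simpleRoot j ∈ AddSubmonoid.closure (Set.range simpleRoot) := by
  refine sum_mem fun j _ => ?_
  obtain ⟨k, hk⟩ := Int.eq_ofNat_of_zero_le (hn j)
  rw [hk, natCast_zsmul]
  exact nsmul_mem (AddSubmonoid.subset_closure (Set.mem_range_self j)) k

lemma mem_or_neg_mem_closure {a : V} (ha : a ∈ realRoots) :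
    a ∈ AddSubmonoid.closure (Set.range simpleRoot) ∨
      -a ∈ AddSubmonoid.closure (Set.range simpleRoot) := by
  obtain ⟨n, rfl, hn | hn⟩ := exists_int_coeff ha
  · exact .inl (sum_mem_closure hn)
  · right
    rw [← Finset.sum_neg_distrib]
    simpa only [neg_smul] using sum_mem_closure hn

lemma span_single_t : Submodule.span ℝ ((Set.range fun i => (Pi.single i t : V)) ∪
    Set.range fun i => (Pi.single i (v * t) : V)) = ⊤ := by
  rw [eq_top_iff]
  rintro x -
  have h3 : √3 ≠ 0 := by positivity
  have hz : ∀ z : ℂ, ∃ α β : ℝ, z = α * t + β * (v * t) := by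
    intro z
    obtain ⟨α, β, h⟩ : ∃ α β : ℝ, z / t = α + β * v := by
      refine ⟨(z / t).re + (z / t).im / √3, 2 * (z / t).im / √3, ?_⟩
      apply Complex.ext
      · rw [Complex.add_re, Complex.ofReal_re, Complex.re_ofReal_mul, v_re]; ring
      · rw [Complex.add_im, Complex.ofReal_im, Complex.im_ofReal_mul, v_im]; field_simp; ring
    rw [div_eq_iff t_ne_zero] at h
    exact ⟨α, β, by rw [h]; ring⟩
  have : x = ∑ i, Pi.single i (x i) := (Finset.univ_sum_single x).symm
  rw [this]
  refine sum_mem fun i _ => ?_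
  obtain ⟨α, β, h⟩ := hz (x i)
  have : (Pi.single i (x i) : V) = α • (Pi.single i t : V) + β • (Pi.single i (v * t) : V) := by
    rw [h]
    ext j
    by_cases hj : j = i
    · subst hj; simp
    · simp [hj]
  rw [this]
  exact add_mem (Submodule.smul_mem _ _ (Submodule.subset_span (.inl ⟨i, rfl⟩)))
    (Submodule.smul_mem _ _ (Submodule.subset_span (.inr ⟨i, rfl⟩)))

lemma span_realRoots : Submodule.span ℝ realRoots = ⊤ := by
  rw [eq_top_iff, ← span_single_t]
  apply Submodule.span_mono
  rintro _ (⟨i, rfl⟩ | ⟨i, rfl⟩)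
  · exact single_t_mem i
  · exact single_mem_realRoots i (sixth_of_cube v_cube)

lemma finrank_V : Module.finrank ℝ V = 6 := by
  simp [Module.finrank_pi_fintype, Complex.finrank_real_complex]

/-- The six vectors span, because every root is an integer combination of them, and the real
dimension is 6. -/
lemma linearIndependent_simpleRoot : LinearIndependent ℝ simpleRoot := by
  apply linearIndependent_of_top_le_span_of_card_eq_finrank
  · rw [← span_realRoots, Submodule.span_le]
    intro a ha
    obtain ⟨n, rfl, -⟩ := exists_int_coeff ha
    refine sum_mem fun j _ => ?_
    rw [← Int.cast_smul_eq_zsmul ℝ]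
    exact Submodule.smul_mem _ _ (Submodule.subset_span ⟨j, rfl⟩)
  · rw [finrank_V, Fintype.card_fin]

/-- The linear map sending each root to its coroot. -/
def corootMap : V →ₗ[ℝ] Module.Dual ℝ V :=
  LinearMap.mk₂ ℝ (fun a x => 2 / 3 * (hdot x a).re)
    (fun a b x => by simp only [hdot_eq, Pi.add_apply, star_add, Complex.add_re, mul_add]; ring)
    (fun c a x => by
      have : hdot x (c • a) = c * hdot x a := by
        simp only [hdot_eq, Pi.smul_apply, Complex.real_smul, star_mul, Complex.star_def,
          Complex.conj_ofReal]
        ring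
      rw [this, Complex.re_ofReal_mul, smul_eq_mul]; ring)
    (fun a x y => by rw [hdot_add_left, Complex.add_re]; ring)
    (fun c a x => by rw [hdot_real_smul_left, Complex.re_ofReal_mul, smul_eq_mul]; ring)

lemma corootMap_apply (a x : V) : corootMap a x = 2 / 3 * (hdot x a).re := rfl

lemma re_hdot_self (x : V) :
    (hdot x x).re = Complex.normSq (x 0) + Complex.normSq (x 1) + Complex.normSq (x 2) := by
  simp [hdot_eq, Complex.normSq_apply]

lemma corootMap_injective : Function.Injective corootMap := by
  rw [injective_iff_map_eq_zero]
  intro a ha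
  have h : corootMap a a = 0 := by rw [ha]; rfl
  rw [corootMap_apply, re_hdot_self] at h
  have h0 := Complex.normSq_nonneg (a 0)
  have h1 := Complex.normSq_nonneg (a 1)
  have h2 := Complex.normSq_nonneg (a 2)
  ext i
  rw [Pi.zero_apply, ← Complex.normSq_eq_zero]
  fin_cases i <;> simp only [Fin.zero_eta, Fin.mk_one, Fin.reduceFinMk] <;> linarith

lemma corootMap_int {a b : V} (ha : a ∈ realRoots) (hb : b ∈ realRoots) :
    ∃ z : ℤ, (z : ℝ) = corootMap b a := by
  obtain ⟨g, hg, rfl⟩ := exists_baseRoot_eq hb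
  obtain ⟨a, rfl⟩ := (realify g).surjective a
  have hA := hessianGroup_le_rootAut hg
  obtain ⟨m, k, rfl⟩ := (mem_realRoots_iff_rootCoords a).1 ((hA.1 a).1 ha)
  -- Once `b` is moved to the base root, the pairing depends only on the imaginary part of the first
  -- entry p + qv, and equals q.
  refine ⟨(rootCoords m k 0).2, ?_⟩
  rw [corootMap_apply, hdot_realify hA, baseRoot, hdot_single_right, star_t, Function.comp_apply,
    eis]
  have h3 : √3 * √3 = 3 := Real.mul_self_sqrt (by norm_num)
  simp [t_re, t_im, v_im]
  linear_combination -(1 / 3) * ((rootCoords m k 0).2 : ℝ) * h3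

lemma rrefl_maps {a : V} (ha : a ∈ realRoots) {x : V} (hx : x ∈ realRoots) :
    rrefl a x ∈ realRoots := ((rrefl_mem_rootAut ha).1 x).2 hx

lemma corootMap_simpleRoot (i j : Fin 6) :
    corootMap (simpleRoot j) (simpleRoot i) = (CartanMatrix.E₆ i j : ℤ) := by
  have hre : ∀ p q : ℤ × ℤ, (eis p * star (eis q)).re =
      ((2 * p.1 * q.1 - p.1 * q.2 - p.2 * q.1 + 2 * p.2 * q.2 : ℤ) : ℝ) / 2 := by
    intro p q
    have h3 : √3 * √3 = 3 := Real.mul_self_sqrt (by norm_num)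
    simp [eis, v_re, v_im]
    linear_combination (p.2 : ℝ) * q.2 / 4 * h3
  -- The sum is twice the real inner product, and the factor 3 is the common squared length of the
  -- roots.
  have hdec : ∀ i j : Fin 6, (∑ k : Fin 3, (2 * (simpleCoords i k).1 * (simpleCoords j k).1 -
      (simpleCoords i k).1 * (simpleCoords j k).2 - (simpleCoords i k).2 * (simpleCoords j k).1 +
      2 * (simpleCoords i k).2 * (simpleCoords j k).2)) = 3 * CartanMatrix.E₆ i j := by
    decide +kernel
  have h := congrArg (fun n : ℤ => (n : ℝ)) (hdec i j)
  rw [corootMap_apply, hdot, Complex.re_sum]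
  simp only [simpleRoot, Function.comp_apply, hre]
  rw [← Finset.sum_div]
  simp only [Int.cast_sum] at h
  rw [h]
  push_cast
  ring

/-- The roots form a root system. -/
def rootPairing : RootPairing realRoots ℝ V (Module.Dual ℝ V) :=
  haveI : Finite realRoots := finite_realRoots
  RootPairing.mk'' (Module.Dual.eval ℝ V) (Function.Embedding.subtype _)
    ((Function.Embedding.subtype _).trans ⟨corootMap, corootMap_injective⟩)
    (fun a => by
      change corootMap a a = 2
      rw [corootMap_apply, hdot_self_of_mem a.2]; norm_num)
    (fun a => by
      rintro _ ⟨x, rfl⟩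
      refine ⟨⟨rrefl a x, rrefl_maps a.2 x.2⟩, ?_⟩
      exact rrefl_apply_of_mem a.2 x)
    (by
      rw [← span_realRoots]
      congr 1
      exact Subtype.range_coe)

lemma isE6WeylGroup : IsE6WeylGroup realRoots realReflectionGroup := by
  have : Finite realRoots := finite_realRoots
  have hroot : ∀ a : realRoots, rootPairing.root a = (a : V) := fun _ => rfl
  have hint : ∀ a b : realRoots, ∃ z : ℤ, (z : ℝ) = Module.Dual.eval ℝ V a (corootMap b) :=
    fun a b => corootMap_int a.2 b.2
  have hsys : rootPairing.IsRootSystem := RootPairing.isRootSystem_mk'' hint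
  have hcry : rootPairing.IsCrystallographic := ⟨hint⟩
  have hred : rootPairing.IsReduced := by
    refine ⟨fun a b h => ?_⟩
    rw [hroot, hroot] at h ⊢
    rw [LinearIndependent.pair_iff' (ne_zero_of_mem_realRoots a.2)] at h
    push Not at h
    obtain ⟨k, hk⟩ := h
    have h1 := hdot_self_of_mem b.2
    rw [← hk, hdot_real_smul_left, ← Complex.coe_smul, hdot_smul_right, hdot_self_of_mem a.2,
      Complex.star_def, Complex.conj_ofReal] at h1
    have h2 : (k : ℂ) ^ 2 = 1 := by linear_combination h1 / 3
    have h3 : k ^ 2 = 1 := by exact_mod_cast h2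
    rcases sq_eq_one_iff.1 h3 with rfl | rfl
    · left; simpa using hk
    · right; rw [← hk]; simp
  let s : Fin 6 → realRoots := fun j => ⟨simpleRoot j, simpleRoot_mem j⟩
  have hcomp : rootPairing.root ∘ s = simpleRoot := rfl
  have hinj : Function.Injective s := fun i j h =>
    linearIndependent_simpleRoot.injective (congrArg Subtype.val h)
  have himage : rootPairing.root '' Set.range s = Set.range simpleRoot := by
    rw [← Set.range_comp, hcomp]
  let b : rootPairing.Base := RootPairing.Base.mk' rootPairing (Set.range s)
    ((linearIndepOn_range_iff hinj _).2 linearIndependent_simpleRoot)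
    (fun a => himage ▸ mem_or_neg_mem_closure a.2)
  have hb : ∀ a, a ∈ b.support ↔ a ∈ Set.range s := fun a => by
    change a ∈ (Set.toFinite (Set.range s)).toFinset ↔ _
    rw [Set.Finite.mem_toFinset]
  let e : Fin 6 ≃ b.support :=
    Equiv.ofBijective (fun j => ⟨s j, (hb _).2 ⟨j, rfl⟩⟩)
      ⟨fun i j h => hinj (congrArg Subtype.val h), fun ⟨a, ha⟩ => by
        obtain ⟨j, rfl⟩ := (hb a).1 ha
        exact ⟨j, rfl⟩⟩
  refine ⟨rootPairing, hsys, hcry, b, e, hroot, ?_, ?_⟩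
  · ext i j
    have h1 := b.algebraMap_cartanMatrixIn_apply ℤ (e i) (e j)
    have h2 : rootPairing.pairing (e i) (e j) = (CartanMatrix.E₆ i j : ℤ) :=
      corootMap_simpleRoot i j
    rw [h2] at h1
    exact Int.cast_injective h1
  · rw [← MonoidHom.domRestrict_range, RootPairing.range_weylGroup_weightHom, realReflectionGroup,
      realReflections_eq]
    congr 1
    have hr : ∀ a : realRoots, rootPairing.reflection a = rrefl a := by
      intro a
      refine LinearEquiv.ext fun x => ?_
      rw [rrefl_apply_of_mem a.2]
      rfl
    ext g
    constructor
    · rintro ⟨a, rfl⟩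
      exact ⟨a, a.2, (hr a).symm⟩
    · rintro ⟨a, ha, rfl⟩
      exact ⟨⟨a, ha⟩, hr _⟩

/-! ### Maximality -/

lemma realify_hessianGroup_le_rotation :
    hessianGroup.map realify ≤ rotationSubgroup realReflectionGroup := by
  rintro _ ⟨g, hg, rfl⟩
  exact ⟨realify_hessianGroup_le hg, det_hessianGroup hg⟩

/-- Since 1 and v form a real basis of ℂ, commuting with v already gives complex linearity, and H
contains every complex linear element of `rootAut`. -/
lemma mem_map_of_complexLinear {g : V ≃ₗ[ℝ] V} (hg : g ∈ rootAut)
    (hv : ∀ x, g (v • x) = v • g x) : g ∈ hessianGroup.map realify := by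
  have hlin : ∀ (z : ℂ) x, g (z • x) = z • g x := by
    intro z x
    have h3 : √3 ≠ 0 := by positivity
    have hz : z = ((z.re + z.im / √3 : ℝ) : ℂ) + ((2 * z.im / √3 : ℝ) : ℂ) * v := by
      apply Complex.ext
      · rw [Complex.add_re, Complex.ofReal_re, Complex.re_ofReal_mul, v_re]; ring
      · rw [Complex.add_im, Complex.ofReal_im, Complex.im_ofReal_mul, v_im]; field_simp; ring
    rw [hz, add_smul, add_smul, mul_smul, mul_smul, Complex.coe_smul, Complex.coe_smul,
      Complex.coe_smul, Complex.coe_smul, map_add, map_smul, map_smul, hv]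
  let f : V ≃ₗ[ℂ] V := { g with map_smul' := hlin }
  let G : GL (Fin 3) ℂ := GeneralLinearGroup.toLin.symm
    (LinearMap.GeneralLinearGroup.ofLinearEquiv f)
  have hG : realify G = g := by
    ext1 x
    have h := GeneralLinearGroup.toLin_apply G x
    rw [MulEquiv.apply_symm_apply] at h
    exact h.symm
  exact ⟨G, mem_hessianGroup_of_mem_rootAut (hG ▸ hg), hG⟩

lemma exists_rotation_not_mem : ∃ g ∈ rotationSubgroup realReflectionGroup,
    g ∉ hessianGroup.map realify := by
  refine ⟨rrefl (Pi.single 0 t) * rrefl (Pi.single 1 t),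
    ⟨mul_mem (rrefl_mem (single_t_mem 0)) (rrefl_mem (single_t_mem 1)), ?_⟩, ?_⟩
  · change LinearEquiv.det (rrefl _ * rrefl _) = 1
    rw [map_mul, det_rrefl (single_t_mem 0),
      det_rrefl (single_t_mem 1)]
    norm_num
  · rintro ⟨g, -, hg⟩
    have h1 : ∀ x : V, realify g x = ![star (x 0), star (x 1), x 2] := by
      intro x
      rw [hg, LinearEquiv.mul_apply, rrefl_single, rrefl_single]
      ext i; fin_cases i <;> simp
    have h2 := realify_smul g v ![1, 0, 1]
    rw [h1, h1] at h2
    have h3 := congrFun h2 0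
    simp [-Complex.star_def, star_v] at h3
    exact v_ne_w h3.symm

/-- Two roots are linked by `L` if the product of their reflections belongs to `L`. -/
def Linked (L : Subgroup (V ≃ₗ[ℝ] V)) (a b : V) : Prop := rrefl a * rrefl b ∈ L

lemma Linked.symm {L : Subgroup (V ≃ₗ[ℝ] V)} {a b : V} (h : Linked L a b) : Linked L b a := by
  have := inv_mem h
  rwa [_root_.mul_inv_rev, rrefl_inv, rrefl_inv] at this

lemma Linked.trans {L : Subgroup (V ≃ₗ[ℝ] V)} {a b c : V} (h : Linked L a b) (h' : Linked L b c) :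
    Linked L a c := by
  have := mul_mem h h'
  rwa [mul_assoc, ← mul_assoc (rrefl b), rrefl_mul_self, one_mul] at this

lemma Linked.neg_right {L : Subgroup (V ≃ₗ[ℝ] V)} {a b : V} (h : Linked L a b) :
    Linked L a (-b) := by
  rwa [Linked, rrefl_neg]

lemma Linked.map {L : Subgroup (V ≃ₗ[ℝ] V)} {a b : V} (h : Linked L a b) {g : V ≃ₗ[ℝ] V}
    (hg : g ∈ L) (hA : g ∈ rootAut) : Linked L (g a) (g b) := by
  have := mul_mem (mul_mem hg h) (inv_mem hg)
  rw [Linked, rrefl_conj hA, rrefl_conj hA]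
  convert this using 1
  group

lemma linked_smul {L : Subgroup (V ≃ₗ[ℝ] V)} (hL : hessianGroup.map realify ≤ L) {a : V}
    (ha : a ∈ realRoots) {u : ℂ} (hu : u ^ 3 = 1) : Linked L (u • a) a := by
  -- Taking eigenvalue u² makes the other root of the factorization (u²)² r = u r.
  have hl : (u ^ 2) ^ 3 = 1 := by rw [← pow_mul, mul_comm, pow_mul, hu, one_pow]
  obtain ⟨g, hg, hx⟩ := exists_complexReflection ha hl
  have h := realify_complexReflection ha hl hx
  have h4 : (u ^ 2) ^ 2 = u := by linear_combination u * hu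
  rw [h4] at h
  rw [Linked, ← h]
  exact hL ⟨g, hg, rfl⟩

lemma linked_smul_sixth {L : Subgroup (V ≃ₗ[ℝ] V)} (hL : hessianGroup.map realify ≤ L) {a : V}
    (ha : a ∈ realRoots) {u : ℂ} (hu : u ^ 6 = 1) : Linked L a (u • a) := by
  rcases (sixth_iff u).1 hu with h | h
  · exact (linked_smul hL ha h).symm
  · simpa using (linked_smul hL ha h).symm.neg_right

/-- If the linking relation contains a pair `(a, b)` with `a` the base root and `b` a root at
angle `120°` outside the complex line of `a`, then all roots are linked. -/
lemma linked_all {L : Subgroup (V ≃ₗ[ℝ] V)} (hL : hessianGroup.map realify ≤ L)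
    {c : V} (hc : ∀ i, c i ^ 3 = 1) (hc0 : c 0 = w ∨ c 0 = v) (h : Linked L baseRoot c) :
    ∀ a ∈ realRoots, Linked L baseRoot a := by
  have hmap : ∀ {a b : V}, Linked L a b → ∀ g ∈ hessianGroup,
      Linked L (realify g a) (realify g b) := fun hab g hg =>
    hab.map (hL ⟨g, hg, rfl⟩) (hessianGroup_le_rootAut hg)
  -- diagonal matrices fixing the base root act transitively on the last two coordinates
  have hdiag : ∀ d : V, (∀ i, d i ^ 3 = 1) → Linked L baseRoot d → ∀ e : V, (∀ i, e i ^ 3 = 1) →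
      e 0 = d 0 → Linked L baseRoot e := by
    intro d hd hl e he h0
    have hq : ∀ i, (![1, e 1 * d 1 ^ 2, e 2 * d 2 ^ 2] : V) i ^ 3 = 1 := by
      intro i
      fin_cases i
      · simp
      · simp only [Fin.mk_one, cons_val]
        rw [mul_pow, he, ← pow_mul, mul_comm 2, pow_mul, hd]; simp
      · simp only [Fin.reduceFinMk, cons_val]
        rw [mul_pow, he, ← pow_mul, mul_comm 2, pow_mul, hd]; simp
    have := hmap hl _ (diagGL_mem _ hq)
    rw [realify_diagGL, realify_diagGL, vec3_mul, vec3_mul] at this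
    convert this using 1
    · ext i; fin_cases i <;> simp [baseRoot]
    · ext i; fin_cases i
      · simp [h0]
      · simp; linear_combination - e 1 * hd 1
      · simp; linear_combination - e 2 * hd 2
  have hone : Linked L baseRoot ![w, 1, 1] := by
    rcases hc0 with h0 | h0
    · exact hdiag c hc h _ (by intro i; fin_cases i <;> simp [w_cube]) (by simp [h0])
    · have h1 : Linked L baseRoot ![v, 1, 1] :=
        hdiag c hc h _ (by intro i; fin_cases i <;> simp [v_cube]) (by simp [h0])
      -- With s the base reflection and s' that of (v, 1, 1), the reflection in (w, 1, 1) is s s' s,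
      -- so its product with s is s' s, the inverse of a known element of `L`.
      have h2 : rrefl baseRoot ![v, 1, 1] = ![w, 1, 1] := by
        rw [baseRoot, rrefl_single]
        ext i; fin_cases i <;> simp [star_v]
      rw [Linked, ← h2, rrefl_conj rrefl_baseRoot_mem_rootAut, rrefl_inv, ← mul_assoc, ← mul_assoc,
        rrefl_mul_self, one_mul]
      exact h1.symm
  have hvec : ∀ e : V, (∀ i, e i ^ 3 = 1) → Linked L baseRoot e := by
    intro e he
    -- This unit rescales the first coordinate of `e` to w, reducing to the case just treated
    -- without leaving the complex line of `e`.
    have hu : (w * e 0 ^ 2) ^ 3 = 1 := by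
      rw [mul_pow, w_cube, ← pow_mul, mul_comm 2, pow_mul, he]; simp
    have h1 : Linked L baseRoot ((w * e 0 ^ 2) • e) := by
      refine hdiag _ (by intro i; fin_cases i <;> simp [w_cube]) hone _ (fun i => ?_) ?_
      · rw [Pi.smul_apply, smul_eq_mul, mul_pow, hu, he, one_mul]
      · simp; linear_combination w * he 0
    exact h1.trans (linked_smul hL (vec_mem_realRoots he) hu)
  have hones : ∀ i, (![1, 1, 1] : V) i ^ 3 = 1 := by intro i; fin_cases i <;> simp
  have hshift : ∀ i, Linked L (Pi.single i t) ![1, 1, 1] := by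
    have h1 : realify shiftGL ![1, 1, 1] = ![1, 1, 1] := by
      rw [realify_shiftGL]; ext i; fin_cases i <;> simp
    have e0 := hvec _ hones
    have e2 := hmap e0 _ shiftGL_mem
    have e1 := hmap e2 _ shiftGL_mem
    rw [h1, baseRoot, shiftGL_single] at e2
    rw [h1, h1, baseRoot, shiftGL_single, shiftGL_single] at e1
    intro i
    fin_cases i
    · exact e0
    · exact e1
    · exact e2
  intro a ha
  rcases (mem_realRoots_iff a).1 ha with ⟨c, hc, rfl | rfl⟩ | ⟨i, u, hu, rfl⟩
  · exact hvec _ hc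
  · exact (hvec _ hc).neg_right
  · have h1 := linked_smul_sixth hL (single_t_mem i) hu
    rw [← Pi.single_smul, smul_eq_mul] at h1
    exact ((hvec _ hones).trans (hshift i).symm).trans h1

lemma rotation_le_of_linked {L : Subgroup (V ≃ₗ[ℝ] V)}
    (hdet : ∀ g ∈ L, LinearEquiv.det g = 1)
    (h : ∀ a ∈ realRoots, Linked L baseRoot a) : rotationSubgroup realReflectionGroup ≤ L := by
  -- The reflection group is covered by `L` and its coset by the base reflection; the determinant
  -- then decides which one contains `g`.
  have key : ∀ g ∈ realReflectionGroup, g ∈ L ∨ rrefl baseRoot * g ∈ L := by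
    intro g hg
    induction hg using Subgroup.closure_induction_left with
    | one => exact .inl (one_mem L)
    | mul_left s hs g hg ih =>
      rw [realReflections_eq] at hs
      obtain ⟨a, ha, rfl⟩ := hs
      rcases ih with h1 | h1
      · right
        rw [← mul_assoc]
        exact mul_mem (h a ha) h1
      · left
        have := mul_mem (h a ha).symm h1
        rwa [mul_assoc, ← mul_assoc (rrefl baseRoot), rrefl_mul_self, one_mul] at this
    | inv_mul_cancel s hs g hg ih =>
      rw [realReflections_eq] at hs
      obtain ⟨a, ha, rfl⟩ := hs
      rw [rrefl_inv]
      rcases ih with h1 | h1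
      · right
        rw [← mul_assoc]
        exact mul_mem (h a ha) h1
      · left
        have := mul_mem (h a ha).symm h1
        rwa [mul_assoc, ← mul_assoc (rrefl baseRoot), rrefl_mul_self, one_mul] at this
  rintro g ⟨hg, hg1⟩
  rcases key g hg with h1 | h1
  · exact h1
  · have := hdet _ h1
    rw [map_mul, det_rrefl baseRoot_mem, show LinearEquiv.det g = 1 from hg1] at this
    have := congrArg Units.val this
    norm_num at this

/-- The two alternatives cannot mix: if a has type v while b and a + b have type w, subtraction
gives v g(a) = w g(a). Adding suitable roots to v(1, 1, 1) yields te₀, te₁ and te₂, so these share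
one type, which extends to the whole space. -/
lemma isLinear_or_antilinear {g : V ≃ₗ[ℝ] V}
    (h : ∀ a ∈ realRoots, g (v • a) = v • g a ∨ g (v • a) = w • g a) :
    (∀ x, g (v • x) = v • g x) ∨ ∀ x, g (v • x) = w • g x := by
  have uniform : ∀ p q : ℂ, p ≠ q →
      (∀ a ∈ realRoots, g (v • a) = p • g a ∨ g (v • a) = q • g a) →
      ∀ a ∈ realRoots, ∀ b ∈ realRoots, a + b ∈ realRoots →
        g (v • a) = p • g a → g (v • (a + b)) = p • g (a + b) := by
    intro p q hpq h a ha b hb hab hga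
    rcases h _ hab with h1 | h1
    · exact h1
    rcases h b hb with h2 | h2
    · rw [smul_add, map_add, hga, h2, map_add, smul_add]
    · rw [smul_add, map_add, hga, h2, map_add, smul_add, add_left_inj] at h1
      exact absurd (smul_left_injective ℂ
        (g.map_ne_zero_iff.2 (ne_zero_of_mem_realRoots ha)) h1) hpq
  have extend : ∀ p : ℂ, p ^ 2 = -1 - p → (∀ i, g (v • Pi.single i t) = p • g (Pi.single i t)) →
      ∀ x, g (v • x) = p • g x := by
    intro p hp hi x
    have hx : x ∈ Submodule.span ℝ ((Set.range fun i => (Pi.single i t : V)) ∪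
        Set.range fun i => (Pi.single i (v * t) : V)) := by
      rw [span_single_t]; trivial
    induction hx using Submodule.span_induction with
    | mem x hx =>
      rcases hx with ⟨i, rfl⟩ | ⟨i, rfl⟩
      · exact hi i
      · change g (v • Pi.single i (v • t)) = p • g (Pi.single i (v • t))
        -- The type passes from te_i to vte_i because both v and `p` satisfy x² = -1 - x.
        have h2 : v • v • (Pi.single i t : V) = -Pi.single i t - v • Pi.single i t := by
          rw [smul_smul, ← sq, v_sq, sub_smul, neg_smul, one_smul]
        rw [Pi.single_smul, h2, map_sub, map_neg, hi, smul_smul, ← sq, hp, sub_smul, neg_smul,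
          one_smul]
    | zero => simp
    | add x y _ _ hx hy => rw [smul_add, map_add, hx, hy, map_add, smul_add]
    | smul c x _ hx => rw [smul_comm, map_smul, hx, map_smul, smul_comm]
  have hsingle : ∀ p q : ℂ, p ≠ q → p ^ 2 = -1 - p →
      (∀ a ∈ realRoots, g (v • a) = p • g a ∨ g (v • a) = q • g a) →
      g (v • (v • ![1, 1, 1])) = p • g (v • ![1, 1, 1]) → ∀ x, g (v • x) = p • g x := by
    intro p q hpq hp h h1
    refine extend p hp fun i => ?_
    have hone : ∀ i, (![1, 1, 1] : V) i ^ 3 = 1 := by intro i; fin_cases i <;> simp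
    have ha : v • ![1, 1, 1] ∈ realRoots :=
      smul_mem_realRoots (vec_mem_realRoots hone) (sixth_of_cube v_cube)
    have hb : (-v) • (Pi.mulSingle i v : V) ∈ realRoots :=
      smul_mem_realRoots (vec_mem_realRoots (mulSingle_cube i v_cube))
        (neg_sixth (sixth_of_cube v_cube))
    have hab : v • ![1, 1, 1] + (-v) • (Pi.mulSingle i v : V) = Pi.single i t := by
      ext j
      by_cases hj : j = i
      · subst hj
        fin_cases j <;> simp [v_mul_v, t, sub_eq_add_neg]
      · rw [Pi.add_apply, Pi.smul_apply, Pi.smul_apply, Pi.mulSingle_eq_of_ne hj,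
          Pi.single_eq_of_ne hj]
        fin_cases j <;> simp
    have := uniform p q hpq h _ ha _ hb (hab ▸ single_t_mem i) h1
    rwa [hab] at this
  have hone : v • ![1, 1, 1] ∈ realRoots :=
    smul_mem_realRoots (vec_mem_realRoots (by intro i; fin_cases i <;> simp))
      (sixth_of_cube v_cube)
  have hw2 : w ^ 2 = -1 - w := by rw [w_eq]; linear_combination v_sq
  rcases h _ hone with h1 | h1
  · exact .inl (hsingle v w v_ne_w v_sq h h1)
  · exact .inr (hsingle w v v_ne_w.symm hw2 (fun a ha => (h a ha).symm) h1)

/-- Otherwise `g` is linear, hence in H, or antilinear. In the latter case coordinatewise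
conjugation, a product of three reflections, carries `g` into H, whose elements have determinant 1,
although the product has determinant -1. -/
lemma exists_root_not_smul {g : V ≃ₗ[ℝ] V} (hg : g ∈ rotationSubgroup realReflectionGroup)
    (hgH : g ∉ hessianGroup.map realify) :
    ∃ a ∈ realRoots, g (v • a) ≠ v • g a ∧ g (v • a) ≠ w • g a := by
  by_contra! hcon
  have hgA := realReflectionGroup_le_rootAut hg.1
  rcases isLinear_or_antilinear (g := g) fun a ha => by
    by_cases h : g (v • a) = v • g a
    · exact .inl h
    · exact .inr (hcon a ha h) with h | h
  · exact hgH (mem_map_of_complexLinear hgA h)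
  · let k := rrefl (Pi.single 0 t) * rrefl (Pi.single 1 t) * rrefl (Pi.single 2 t)
    have hk : k ∈ rootAut := mul_mem (mul_mem (rrefl_mem_rootAut (single_t_mem 0))
      (rrefl_mem_rootAut (single_t_mem 1))) (rrefl_mem_rootAut (single_t_mem 2))
    have hkx : ∀ x, k x = star x := by
      intro x
      simp only [k, LinearEquiv.mul_apply, rrefl_single]
      ext i; fin_cases i <;> simp
    have hkg : k * g ∈ hessianGroup.map realify := by
      refine mem_map_of_complexLinear (mul_mem hk hgA) fun x => ?_
      change k (g (v • x)) = v • k (g x)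
      rw [h, hkx, hkx, star_smul, star_w]
    have hdet := (realify_hessianGroup_le_rotation hkg).2
    change LinearEquiv.det (k * g) = 1 at hdet
    rw [map_mul, show LinearEquiv.det g = 1 from hg.2] at hdet
    simp only [k, map_mul, det_rrefl (single_t_mem _)] at hdet
    have := congrArg Units.val hdet
    norm_num at this

lemma isMaximalSubgroupOf_rotationSubgroup :
    IsMaximalSubgroupOf (hessianGroup.map realify) (rotationSubgroup realReflectionGroup) := by
  refine ⟨lt_of_le_of_ne realify_hessianGroup_le_rotation ?_, fun L hL hLW => ?_⟩
  · intro h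
    obtain ⟨g, hg, hg'⟩ := exists_rotation_not_mem
    exact hg' (h ▸ hg)
  obtain ⟨g, hgL, hgH⟩ := SetLike.exists_of_lt hL
  have hgA := realReflectionGroup_le_rootAut (hLW hgL).1
  obtain ⟨a, ha, hv, hw⟩ := exists_root_not_smul (hLW hgL) hgH
  obtain ⟨h, hh, hb⟩ := exists_baseRoot_eq ((hgA.1 a).2 ha)
  have hA := hessianGroup_le_rootAut hh
  have hvA : v • a ∈ realRoots := smul_mem_realRoots ha (sixth_of_cube v_cube)
  obtain ⟨c, hc⟩ := (realify h).surjective (g (v • a))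
  have hcR : c ∈ realRoots := (hA.1 c).1 (by rw [hc]; exact (hgA.1 _).2 hvA)
  -- All maps involved are isometries, so this is the real inner product of va with a, namely Re 3v.
  have hre : (hdot c baseRoot).re = -3 / 2 := by
    rw [← hA.2.2, hc, hb, hgA.2.2, hdot_smul_left, hdot_self_of_mem ha]
    simp [v_re]
    norm_num
  have hlink : Linked L baseRoot c := by
    have h1 := ((linked_smul hL.le ha v_cube).map hgL hgA).symm
    rw [← hc, ← hb] at h1
    have h2 := h1.map (inv_mem (hL.le ⟨h, hh, rfl⟩)) (inv_mem hA)
    rwa [← LinearEquiv.mul_apply, ← LinearEquiv.mul_apply, inv_mul_cancel] at h2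
  have h3 : √3 * √3 = 3 := Real.mul_self_sqrt (by norm_num)
  rw [baseRoot, hdot_single_right, star_t] at hre
  refine le_antisymm hLW (rotation_le_of_linked (fun g hg => (hLW hg).2) ?_)
  rcases (mem_realRoots_iff c).1 hcR with ⟨d, hd, rfl | rfl⟩ | ⟨i, u, hu, rfl⟩
  · refine linked_all hL.le hd ?_ hlink
    rcases (cube_eq_one_iff _).1 (hd 0) with h0 | h0 | h0 <;> rw [h0] at hre
    · simp [t_re] at hre; norm_num at hre
    · exact .inr h0
    · exact .inl h0
  · have hlink' : Linked L baseRoot d := by simpa using hlink.neg_right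
    refine linked_all hL.le hd ?_ hlink'
    rcases (cube_eq_one_iff _).1 (hd 0) with h0 | h0 | h0
    · rw [Pi.neg_apply, h0] at hre
      simp [t_re] at hre; norm_num at hre
    · exact .inr h0
    · exact .inl h0
  -- On an axis the inner product forces index 0 and Re u = -1/2, so u is v or w, which the choice
  -- of `a` forbids.
  · exfalso
    by_cases hi : i = 0
    · subst hi
      rw [Pi.single_eq_same] at hre
      have hure : u.re = -1 / 2 := by
        have : u * t * -t = (3 : ℝ) * u := by
          push_cast; linear_combination (-u) * t_mul_t
        rw [this, Complex.re_ofReal_mul] at hre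
        linarith
      have hcu : (Pi.single 0 (u * t) : V) = u • baseRoot := by
        rw [baseRoot, ← Pi.single_smul, smul_eq_mul]
      rw [hcu, realify_smul, hb] at hc
      rcases (sixth_iff u).1 hu with h6 | h6
      · rcases (cube_eq_one_iff _).1 h6 with rfl | rfl | rfl
        · norm_num at hure
        · exact hv hc.symm
        · exact hw hc.symm
      · rcases (cube_eq_one_iff _).1 h6 with h7 | h7 | h7 <;>
          have h8 := congrArg Complex.re h7 <;>
          simp [v_re, w_re, hure] at h8 <;> norm_num at h8
    · rw [Pi.single_eq_of_ne' hi] at hre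
      norm_num at hre

end HessianE6

end

theorem mainTheorem5 :
    -- the group of order 648, its twelve mirrors and its generation by reflections
    (Nat.card HessianE6.hessianGroup = 648 ∧
      HessianE6.mirrors.ncard = 12 ∧
      HessianE6.complexReflections.ncard = 24 ∧
      Subgroup.closure HessianE6.complexReflections = HessianE6.hessianGroup) ∧
    -- the real reflections, and the group that they generate
    (HessianE6.realRoots.ncard = 72 ∧
      HessianE6.realReflections.ncard = 36 ∧
      HessianE6.IsE6WeylGroup HessianE6.realRoots HessianE6.realReflectionGroup) ∧
    -- the group of order 648 is maximal in the rotation subgroup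
    (Function.Injective HessianE6.realify ∧
      HessianE6.IsMaximalSubgroupOf (HessianE6.hessianGroup.map HessianE6.realify)
        (HessianE6.rotationSubgroup HessianE6.realReflectionGroup)) := by
  exact ⟨⟨HessianE6.card_hessianGroup, HessianE6.ncard_mirrors,
      HessianE6.ncard_complexReflections, HessianE6.closure_complexReflections⟩,
    ⟨HessianE6.ncard_realRoots, HessianE6.ncard_realReflections, HessianE6.isE6WeylGroup⟩,
    HessianE6.realify_injective, HessianE6.isMaximalSubgroupOf_rotationSubgroup⟩
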